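/- Let $m\ge 0$, let $C$ be a symmetric $m\times m$ integer matrix and let $n_1,\dots,n_m$ be nonnegative integers. Put $$P_C(x_1,\dots,x_m)=\sum_{d_1,\dots,d_m\ge 0}\frac{(-q^{1/2})^{\sum_{i,j}C_{i,j}d_id_j}}{(q;q)_{d_1}\cdots(q;q)_{d_m}}\,x_1^{d_1}\cdots x_m^{d_m},\qquad (q;q)_d=\prod_{k=1}^d(1-q^k),$$ and let $$y(x_1,\dots,x_m)=\lim_{q\to1}\frac{P_C(q^{n_1}x_1,\dots,q^{n_m}x_m)}{P_C(x_1,\dots,x_m)},$$ where quotient and limit are those of formal power series in $x_1,\dots,x_m$ (the limit is taken coefficientwise, $q$ real, $q\neq 1$). This limit exists and has constant coefficient $1$. Call a set $\Sigma$ of pairs $(i,j)$, $1\le i,j\le m$, *admissible* if no two of its pairs have the same second entry and the directed graph with arrows $i\to j$, $(i,j)\in\Sigma$, has no directed cycle (loops included). For $l=(l_1,\dots,l_m)\in\mathbb Z_{\ge0}^m$, $l\ne 0$, let $$A_{\max}(l)=n_1\cdots n_m\sum_{\Sigma\text{ admissible},\ |\Sigma|=m-1}\ \prod_{(i,j)\in\Sigma}C_{i,j}\,l_i\,n_j^{-1},$$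 $$c_l=A_{\max}(l)\prod_{j=1}^m\frac{1}{\sum_{i=1}^m C_{i,j}l_i}\binom{\sum_{i=1}^m C_{i,j}l_i}{l_j},\qquad \binom{X}{k}=\frac{X(X-1)\cdots(X-k+1)}{k!}.$$ When a denominator vanishes, $c_l$ is understood after cancellation: for the given $l$, regard $c_l$ as a rational function of indeterminates $C_{i,j}$ $(1\le i,j\le m)$ and $n_j$; this rational function is regular at the given values of $C$ and $n$, and $c_l$ denotes its value there. Then $$\log y(x_1,\dots,x_m)=\sum_{l\neq 0}(-1)^{\sum_{i=1}^m(C_{i,i}+1)l_i}\;c_l\;x_1^{l_1}\cdots x_m^{l_m}.$$ Suppose moreover that all $n_i\ge 1$, and put $y(x)=y(x^{n_1},\dots,x^{n_m})$. Then $$x\,(\log y(x))'=\sum_{l\neq0}(-1)^{\sum_{i=1}^m(C_{i,i}+1)l_i}\;c_l\;(n_1l_1+\dots+n_ml_m)\;x^{n_1l_1+\dots+n_ml_m}.$$ Write $x(\log y(x))'=\sum_{r\ge1} a_rx^r$. There are functions $f_r(q)$, $r\ge 1$, $0<q<1$, with $$P_C(x^{n_1},\dots,x^{n_m})=\exp\Big(\sum_{k,r\ge1}\tfrac1k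 f_r(q^k)\,x^{rk}\Big)\qquad(0<q<1),$$ and for any such functions and every $r\ge1$ $$\lim_{q\to1^-}(q^{1/2}-q^{-1/2})\,f_r(q)=\frac1{r^2}\sum_{d\mid r}\mu(d)\,a_{r/d}.$$ In particular, if $f_r(q)=\sum_{j\in\mathbb Z} N_{r,j}\,q^{j/2}/(q^{1/2}-q^{-1/2})$ for all $r$, where for each $r$ only finitely many of the real numbers $N_{r,j}$ are nonzero, then the BPS-like numbers $N_r=\sum_jN_{r,j}$ are $$N_r=\frac1{r^2}\sum_{d\mid r}\mu(d)\,a_{r/d}.$$ -/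

import Mathlib

open Filter Topology

noncomputable section

/-- The `q`-Pochhammer symbol `(q;q)_d = (1 - q)(1 - q^2)⋯(1 - q^d)`. -/
def qPochhammer (q : ℝ) (d : ℕ) : ℝ :=
  ∏ k ∈ Finset.range d, (1 - q ^ (k + 1))

/-- The quiver generating series
`P_C = ∑_d (-q^{1/2})^{∑_{i,j} C_{ij} d_i d_j} / ((q;q)_{d_1} ⋯ (q;q)_{d_m}) x_1^{d_1} ⋯ x_m^{d_m}`
at a real number `q`, as a formal power series in `x_1, …, x_m`. -/
def quiverSeries {m : ℕ} (C : Matrix (Fin m) (Fin m) ℤ) (q : ℝ) : MvPowerSeries (Fin m) ℝ :=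
  fun d => (-√q) ^ (∑ i, ∑ j, C i j * (d i : ℤ) * (d j : ℤ)) / ∏ i, qPochhammer q (d i)

/-- The quotient `P_C(q^{n_1} x_1, …, q^{n_m} x_m) / P_C(x_1, …, x_m)` of formal power series. -/
def quiverQuotient {m : ℕ} (C : Matrix (Fin m) (Fin m) ℤ) (n : Fin m → ℕ) (q : ℝ) :
    MvPowerSeries (Fin m) ℝ :=
  MvPowerSeries.rescale (fun i => q ^ n i) (quiverSeries C q) * (quiverSeries C q)⁻¹

/-- The classical limit `y(x_1, …, x_m)`: the coefficientwise limit as `q → 1` of the quotient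
`P_C(q^{n_1} x_1, …, q^{n_m} x_m) / P_C(x_1, …, x_m)`. -/
def classicalLimit {m : ℕ} (C : Matrix (Fin m) (Fin m) ℤ) (n : Fin m → ℕ) :
    MvPowerSeries (Fin m) ℝ :=
  fun l => limUnder (𝓝[≠] (1 : ℝ)) (fun q => MvPowerSeries.coeff l (quiverQuotient C n q))

/-- `log f = ∑_{k ≥ 1} (-1)^{k+1} (f - 1)^k / k` for a formal power series `f` with constant
coefficient `1`. -/
def mvLog {m : ℕ} (f : MvPowerSeries (Fin m) ℝ) : MvPowerSeries (Fin m) ℝ :=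
  (PowerSeries.log ℝ).subst (f - 1)

/-- The specialization `x_i = x^{n_i}` (for positive `n_i`). -/
def diagSpecialize {m : ℕ} (n : Fin m → ℕ) (f : MvPowerSeries (Fin m) ℝ) : PowerSeries ℝ :=
  MvPowerSeries.subst (fun i => (PowerSeries.X : PowerSeries ℝ) ^ n i) f

/-- The coefficients `a_r` of `x (log y(x))'`, where `y(x) = y(x^{n_1}, …, x^{n_m})`. -/
def logDerivCoeff {m : ℕ} (C : Matrix (Fin m) (Fin m) ℤ) (n : Fin m → ℕ) (r : ℕ) : ℝ :=
  PowerSeries.coeff r (PowerSeries.X *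
    PowerSeries.derivative ℝ (PowerSeries.logOf (diagSpecialize n (classicalLimit C n))))

/-- A set of pairs `(i, j)` is admissible if no two of its pairs have the same second entry and,
read as the set of arrows `i → j` of a directed graph, it has no cycle of any length
(loops included). -/
def IsAdmissible {m : ℕ} (S : Finset (Fin m × Fin m)) : Prop :=
  (∀ p ∈ S, ∀ p' ∈ S, p.2 = p'.2 → p = p') ∧
    ∀ i, ¬ Relation.TransGen (fun a b => (a, b) ∈ S) i i

open Classical in
/-- `A_max(l) = n_1 ⋯ n_m ∑_S ∏_{(i,j) ∈ S} C_{ij} l_i n_j^{-1}`, the sum being over the admissible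
sets `S` of size `m - 1`. -/
def Amax {K : Type*} [Field K] {m : ℕ} (c : Fin m → Fin m → K) (n : Fin m → K)
    (l : Fin m → ℕ) : K :=
  (∏ j, n j) * ∑ S ∈ (Finset.univ.powersetCard (m - 1)).filter IsAdmissible,
    ∏ p ∈ S, c p.1 p.2 * (l p.1 : K) * (n p.2)⁻¹

/-- The binomial coefficient `X (X - 1) ⋯ (X - k + 1) / k!`. -/
def binom {K : Type*} [Field K] (X : K) (k : ℕ) : K :=
  (∏ t ∈ Finset.range k, (X - (t : K))) / (k.factorial : K)

/-- `A_max(l) ∏_j (1 / X_j) binom(X_j, l_j)` with `X_j = ∑_i C_{ij} l_i`. -/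
def logTerm {K : Type*} [Field K] {m : ℕ} (c : Fin m → Fin m → K) (n : Fin m → K)
    (l : Fin m → ℕ) : K :=
  Amax c n l * ∏ j, (1 / ∑ i, c i j * (l i : K)) * binom (∑ i, c i j * (l i : K)) (l j)

/-- Names of the indeterminates: `C_{ij}` is `Sum.inl (i, j)` and `n_j` is `Sum.inr j`. -/
abbrev Par (m : ℕ) : Type := (Fin m × Fin m) ⊕ Fin m

/-- The field of rational functions over `ℚ` in the indeterminates `C_{ij}` and `n_j`. -/
abbrev ParField (m : ℕ) : Type := FractionRing (MvPolynomial (Par m) ℚ)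

/-- The indeterminate named `s`, as a rational function. -/
def parVar {m : ℕ} (s : Par m) : ParField m :=
  algebraMap (MvPolynomial (Par m) ℚ) (ParField m) (MvPolynomial.X s)

/-- The point of parameter space given by a concrete matrix `C` and concrete levels `n`. -/
def parPoint {m : ℕ} (C : Matrix (Fin m) (Fin m) ℤ) (n : Fin m → ℕ) : Par m → ℝ :=
  Sum.elim (fun p => (C p.1 p.2 : ℝ)) (fun j => (n j : ℝ))

/-- The expression `logTerm` for a fixed `l`, as a rational function of the indeterminates
`C_{ij}` and `n_j`. -/
def logTermRat {m : ℕ} (l : Fin m → ℕ) : ParField m :=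
  logTerm (fun i j => parVar (Sum.inl (i, j))) (fun j => parVar (Sum.inr j)) l

/-- The rational function `F` is regular at the point `a`, with value `v` there: after
cancellation `F` can be written as a quotient `p / d` with `d(a) ≠ 0`, and `v = p(a) / d(a)`. -/
def HasValueAt {m : ℕ} (F : ParField m) (a : Par m → ℝ) (v : ℝ) : Prop :=
  ∃ p d : MvPolynomial (Par m) ℚ, MvPolynomial.aeval a d ≠ 0 ∧
    F = algebraMap _ (ParField m) p / algebraMap _ (ParField m) d ∧
    v = MvPolynomial.aeval a p / MvPolynomial.aeval a d

/-- The functions `f_r(q)`, `r ≥ 1`, `0 < q < 1`, are those of the BPS expansion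
`P(x, q) = exp (∑_{k, r ≥ 1} (1/k) f_r(q^k) x^{rk})`, where
`P(x, q) = P_C(x^{n_1}, …, x^{n_m})`. -/
def IsBPSExpansion {m : ℕ} (C : Matrix (Fin m) (Fin m) ℤ) (n : Fin m → ℕ) (f : ℕ → ℝ → ℝ) :
    Prop :=
  ∀ q : ℝ, 0 < q → q < 1 →
    diagSpecialize n (quiverSeries C q) =
      (PowerSeries.exp ℝ).subst (PowerSeries.mk fun s =>
        ∑ kr ∈ s.divisorsAntidiagonal, (1 / (kr.1 : ℝ)) * f kr.2 (q ^ kr.1))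

/-- `f_r(q) = ∑_j N_{r,j} q^{j/2} / (q^{1/2} - q^{-1/2})`, for numbers `N_{r,j}` of which, for each
`r`, only finitely many are nonzero. -/
def bpsFunction (N : ℕ → ℤ →₀ ℝ) (r : ℕ) (q : ℝ) : ℝ :=
  ((N r).sum fun j v => v * (√q) ^ j) / (√q - (√q)⁻¹)

end

/-! Write `Y_v` for `P_C(q^{v_1} x_1, …) / P_C(x)`, with `v` an integer vector. Since `1 - q^{d_i}`
cancels the last factor of `(q;q)_{d_i}`, the series `P_C` satisfies a `q`-difference equation,
which gives `Y_v - Y_{v+e_i} = (-√q)^{C_ii} q^{v_i} x_i Y_{v+C_i}`, with `Y_0 = 1`. By induction on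
the degree, these relations fix the limit of every coefficient. The limits are therefore found by
exhibiting a solution of the limiting recursion: up to sign, the coefficient at `x^l` is `∏_i
binom(Z_i, l_i)/Z_i · det(Z_i δ_ij - l_i C_ij)` with `Z_i = v_i + ∑_a C_ai l_a`. The recursion is
Pascal's rule in one row of the determinant (`lagrangeCoeff_succ`), and the initial value at `v = 0`
holds because the matrix is then singular.

The limit is multiplicative in `v`, so the shift `N n` gives `y^N`. Its coefficients are polynomials
in `N`, and the derivative at `N = 0` is the coefficient of `log y` (`coeff_mvLog_classicalLimit`).
As the determinant vanishes there, only its own derivative survives: a sum of `n_r` times diagonal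
cofactors. The matrix-forest theorem (`det_sum_edgeVector`) turns this sum into `A_max(l)`. All of
this is kept in a division-free form, `cancelledTerm`, which is the value of the rational function
`c_l` everywhere.

For the BPS part, put `x_i = x^{n_i}`: the quotient becomes `P(qx)/P(x)`. Its logarithmic derivative
has coefficients `s (q^s - 1) b_s(q)`, where `b_s` are those of `log P`, and these tend to `a_s`
(`tendsto_expansionCoeff`). Möbius inversion of `b_s(q) = ∑_{kr=s} f_r(q^k)/k` then gives the limit
of `f_r`. -/

noncomputable section

/-! ### Determinantal coefficients and their Pascal recursion -/

section LagrangeDeterminant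

variable {R : Type*} [CommRing R] [Algebra ℚ R] {m : ℕ}

/-- `binom(Z, k) / Z` as a polynomial in `Z` for `k > 0`, and `1` for `k = 0`. -/
def reducedBinom (Z : R) (k : ℕ) : R :=
  algebraMap ℚ R ((k.factorial : ℚ)⁻¹) * ∏ t ∈ Finset.range (k - 1), (Z - ((t : R) + 1))

@[simp] lemma reducedBinom_zero (Z : R) : reducedBinom Z 0 = 1 := by simp [reducedBinom]

lemma map_reducedBinom {R' : Type*} [CommRing R'] [Algebra ℚ R'] (φ : R →+* R') (Z : R) (k : ℕ) :
    φ (reducedBinom Z k) = reducedBinom (φ Z) k := by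
  simp [reducedBinom, map_prod, RingHom.map_rat_algebraMap]

/-- The matrix with rows `Z_i e_i - l_i c_i`, except that the row is `e_i` where `l_i = 0`. -/
def flowMatrix (c : Fin m → Fin m → R) (Z : Fin m → R) (l : Fin m → ℕ) :
    Matrix (Fin m) (Fin m) R :=
  Matrix.of fun i j => if l i = 0 then (if i = j then 1 else 0)
    else (if i = j then Z i else 0) - c i j * (l i : R)

/-- The linear form `∑_i c_{ij} l_i`. -/
def inflow (c : Fin m → Fin m → R) (l : Fin m → ℕ) (j : Fin m) : R := ∑ i, c i j * (l i : R)

/-- The product of the reduced binomials and of the determinant of the flow matrix. -/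
def flowDet (c : Fin m → Fin m → R) (Z : Fin m → R) (l : Fin m → ℕ) : R :=
  (∏ i, reducedBinom (Z i) (l i)) * (flowMatrix c Z l).det

/-- The Lagrange coefficient of `x^l` in the `v`-th power of the solution of the Nahm equations,
up to the signs of the variables. -/
def lagrangeCoeff (c : Fin m → Fin m → R) (l : Fin m → ℕ) (v : Fin m → R) : R :=
  (-1) ^ (∑ i, l i) * flowDet c (fun i => v i + inflow c l i) l

/-- The matrix of `flowDet`, with the reduced binomials multiplied into the rows. -/
def scaledFlowMatrix (c : Fin m → Fin m → R) (Z : Fin m → R) (l : Fin m → ℕ) :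
    Matrix (Fin m) (Fin m) R :=
  Matrix.of fun i j => reducedBinom (Z i) (l i) * flowMatrix c Z l i j

lemma flowDet_eq_det (c : Fin m → Fin m → R) (Z : Fin m → R) (l : Fin m → ℕ) :
    flowDet c Z l = (scaledFlowMatrix c Z l).det :=
  (Matrix.det_mul_column _ _).symm

variable {R' : Type*} [CommRing R'] [Algebra ℚ R']

lemma map_inflow (φ : R →+* R') (c : Fin m → Fin m → R) (l : Fin m → ℕ) (j : Fin m) :
    φ (inflow c l j) = inflow (fun i j => φ (c i j)) l j := by
  simp [inflow]

lemma map_flowMatrix (φ : R →+* R') (c : Fin m → Fin m → R) (Z : Fin m → R) (l : Fin m → ℕ) :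
    (flowMatrix c Z l).map φ = flowMatrix (fun i j => φ (c i j)) (fun i => φ (Z i)) l := by
  ext i j
  simp only [flowMatrix, Matrix.map_apply, Matrix.of_apply]
  split_ifs <;> simp

lemma map_lagrangeCoeff (φ : R →+* R') (c : Fin m → Fin m → R) (l : Fin m → ℕ) (v : Fin m → R) :
    φ (lagrangeCoeff c l v) = lagrangeCoeff (fun i j => φ (c i j)) l (fun i => φ (v i)) := by
  simp only [lagrangeCoeff, flowDet, map_mul, map_pow, map_neg, map_one, map_prod,
    map_reducedBinom, map_add, map_inflow, RingHom.map_det, RingHom.mapMatrix_apply,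
    map_flowMatrix]

lemma flowDet_zero (c : Fin m → Fin m → R) (Z : Fin m → R) : flowDet c Z 0 = 1 := by
  have : flowMatrix c Z 0 = 1 := by ext i j; simp [flowMatrix, Matrix.one_apply]
  simp [flowDet, this]

@[simp] lemma lagrangeCoeff_zero (c : Fin m → Fin m → R) (v : Fin m → R) :
    lagrangeCoeff c 0 v = 1 := by
  simp [lagrangeCoeff, flowDet_zero]

/-- At `Z = inflow` the rows `Z_i e_i - l_i c_i` sum to zero. A row replaced by `e_i` gets weight
`Z_i` to keep this relation, which is nontrivial because some `l_i ≠ 0` has weight `1`. -/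
lemma det_flowMatrix_inflow [IsDomain R] (c : Fin m → Fin m → R) (l : Fin m → ℕ) (hl : l ≠ 0) :
    (flowMatrix c (inflow c l) l).det = 0 := by
  rw [← Matrix.exists_vecMul_eq_zero_iff]
  refine ⟨fun i => if l i = 0 then inflow c l i else 1, ?_, ?_⟩
  · obtain ⟨i, hi⟩ := Function.ne_iff.mp hl
    refine Function.ne_iff.mpr ⟨i, ?_⟩
    have hi' : l i ≠ 0 := hi
    simp [hi']
  · ext j
    have key : ∀ i, (if l i = 0 then inflow c l i else 1) * flowMatrix c (inflow c l) l i j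
        = (if i = j then inflow c l i else 0) - c i j * (l i : R) := by
      intro i
      by_cases h : l i = 0 <;> simp [flowMatrix, h]
    simp only [Matrix.vecMul, dotProduct, key, Finset.sum_sub_distrib, Pi.zero_apply]
    simp [inflow]

lemma lagrangeCoeff_at_zero [IsDomain R] (c : Fin m → Fin m → R) (l : Fin m → ℕ) (hl : l ≠ 0) :
    lagrangeCoeff c l 0 = 0 := by
  have := det_flowMatrix_inflow c l hl
  simp [lagrangeCoeff, flowDet, this]

/-- Since `k binom(Z,k)/Z = binom(Z-1,k-1)`, an entry of the scaled matrix is `d binom(Z,k) - c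
binom(Z-1,k-1)`, and both binomials obey Pascal's rule. For `k = 0` the second one is absent, which
matches the convention for rows with `l_i = 0`. -/
lemma reducedBinom_succ_pascal (Z d c : R) (k : ℕ) :
    reducedBinom (Z + 1) (k + 1) * ((Z + 1) * d - c * ((k + 1 : ℕ) : R)) =
      reducedBinom Z (k + 1) * (Z * d - c * ((k + 1 : ℕ) : R)) +
        reducedBinom Z k * (if k = 0 then d else Z * d - c * (k : R)) := by
  rcases k with _ | k
  · simp [reducedBinom]; ring
  · have h1 : ∏ t ∈ Finset.range (k + 1), (Z + 1 - ((t : R) + 1)) =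
        Z * ∏ t ∈ Finset.range k, (Z - ((t : R) + 1)) := by
      rw [Finset.prod_range_succ', mul_comm]
      congr 1
      · simp
      · exact Finset.prod_congr rfl fun t _ => by push_cast; ring
    have h2 : algebraMap ℚ R (((k + 1).factorial : ℚ)⁻¹) =
        ((k : R) + 2) * algebraMap ℚ R (((k + 1 + 1).factorial : ℚ)⁻¹) := by
      have : ((k : R) + 2) = algebraMap ℚ R ((k : ℚ) + 2) := by
        rw [map_add, map_natCast, map_ofNat]
      rw [this, ← map_mul, Nat.factorial_succ (k + 1)]
      congr 1
      have : ((k + 1).factorial : ℚ) ≠ 0 := by positivity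
      push_cast
      field_simp
      ring
    simp only [reducedBinom, Nat.add_sub_cancel, h1, h2, Nat.add_eq_zero_iff, one_ne_zero,
      and_false, if_false]
    rw [Finset.prod_range_succ]
    push_cast
    ring

lemma scaledFlowMatrix_apply_congr (c : Fin m → Fin m → R) {Z Z' : Fin m → R}
    {l l' : Fin m → ℕ} {i : Fin m} (hZ : Z i = Z' i) (hl : l i = l' i) (j : Fin m) :
    scaledFlowMatrix c Z l i j = scaledFlowMatrix c Z' l' i j := by
  simp only [scaledFlowMatrix, flowMatrix, Matrix.of_apply, hZ, hl]

/-- Only row `i` depends on `Z_i` and `l_i`; Pascal's rule splits that row into a sum, and the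
determinant is additive in it. -/
lemma flowDet_succ (c : Fin m → Fin m → R) (Z : Fin m → R) (l : Fin m → ℕ) (i : Fin m) :
    flowDet c (Z + Pi.single i 1) (l + Pi.single i 1) =
      flowDet c Z (l + Pi.single i 1) + flowDet c Z l := by
  simp only [flowDet_eq_det]
  set A := scaledFlowMatrix c Z (l + Pi.single i 1)
  set B := scaledFlowMatrix c Z l
  have hB : B = A.updateRow i (B i) := by
    ext a j
    rcases eq_or_ne a i with rfl | ha
    · simp
    · rw [Matrix.updateRow_ne ha]
      exact scaledFlowMatrix_apply_congr c rfl (by simp [ha]) j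
  have hM : scaledFlowMatrix c (Z + Pi.single i 1) (l + Pi.single i 1) =
      A.updateRow i (A i + B i) := by
    ext a j
    rcases eq_or_ne a i with rfl | ha
    · have := reducedBinom_succ_pascal (Z a) (if a = j then 1 else 0) (c a j) (l a)
      simp only [Matrix.updateRow_self, Pi.add_apply, A, B, scaledFlowMatrix, flowMatrix,
        Matrix.of_apply, Pi.single_eq_same, Nat.add_eq_zero_iff, one_ne_zero, and_false, if_false]
      simpa [mul_ite] using this
    · rw [Matrix.updateRow_ne ha]
      exact scaledFlowMatrix_apply_congr c (by simp [ha]) rfl j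
  rw [hM, Matrix.det_updateRow_add, Matrix.updateRow_eq_self, ← hB]

lemma inflow_add_single (c : Fin m → Fin m → R) (l : Fin m → ℕ) (i j : Fin m) :
    inflow c (l + Pi.single i 1) j = inflow c l j + c i j := by
  simp only [inflow, Pi.add_apply, Nat.cast_add, mul_add, Finset.sum_add_distrib]
  congr 1
  rw [Finset.sum_eq_single i] <;> simp +contextual

/-- The limiting `q`-difference equation, without its sign. It is `flowDet_succ` at `Z = v + inflow
c (l + e_i) = (v + c_i) + inflow c l`; the sign `(-1)^{|l|}` turns the sum into a difference. -/
lemma lagrangeCoeff_succ (c : Fin m → Fin m → R) (l : Fin m → ℕ) (v : Fin m → R) (i : Fin m) :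
    lagrangeCoeff c (l + Pi.single i 1) v - lagrangeCoeff c (l + Pi.single i 1) (v + Pi.single i 1)
      = lagrangeCoeff c l (v + c i) := by
  have h := flowDet_succ c (fun j => v j + inflow c (l + Pi.single i 1) j) l i
  have e1 : (fun j => v j + inflow c (l + Pi.single i 1) j) + Pi.single i 1 =
      fun j => (v + Pi.single i 1 : Fin m → R) j + inflow c (l + Pi.single i 1) j := by
    ext j; simp only [Pi.add_apply]; ring
  have e2 : (fun j => v j + inflow c (l + Pi.single i 1) j) =
      fun j => (v + c i) j + inflow c l j := by
    ext j; simp only [Pi.add_apply, inflow_add_single]; ring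
  have e3 : ∑ j, (l + Pi.single i 1 : Fin m → ℕ) j = ∑ j, l j + 1 := by
    simp [Finset.sum_add_distrib]
  rw [e1] at h
  simp only [lagrangeCoeff, h, e3, pow_succ]
  rw [e2]
  ring

lemma lagrangeCoeff_add_single_of_eq_zero (c : Fin m → Fin m → R) (l : Fin m → ℕ)
    (v : Fin m → R) (i : Fin m) (hi : l i = 0) :
    lagrangeCoeff c l (v + Pi.single i 1) = lagrangeCoeff c l v := by
  simp only [lagrangeCoeff, flowDet_eq_det]
  congr 2
  ext a j
  rcases eq_or_ne a i with rfl | ha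
  · simp [scaledFlowMatrix, flowMatrix, hi]
  · exact scaledFlowMatrix_apply_congr c (by simp [ha]) rfl j

end LagrangeDeterminant

/-! ### The `q`-difference equation and the classical limit -/

section ShiftedQuotient

variable {m : ℕ}

/-- The quotient `P_C(q^{v_1} x_1, …, q^{v_m} x_m) / P_C(x_1, …, x_m)` for an integer vector `v`. -/
def shiftQuotient (C : Matrix (Fin m) (Fin m) ℤ) (v : Fin m → ℤ) (q : ℝ) :
    MvPowerSeries (Fin m) ℝ :=
  MvPowerSeries.rescale (fun i => q ^ v i) (quiverSeries C q) * (quiverSeries C q)⁻¹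

lemma quiverQuotient_eq_shiftQuotient (C : Matrix (Fin m) (Fin m) ℤ) (n : Fin m → ℕ) (q : ℝ) :
    quiverQuotient C n q = shiftQuotient C (fun i => (n i : ℤ)) q := by
  simp [quiverQuotient, shiftQuotient]

/-- The quadratic form of `C`. -/
def quadForm (C : Matrix (Fin m) (Fin m) ℤ) (d : Fin m → ℕ) : ℤ :=
  ∑ i, ∑ j, C i j * (d i : ℤ) * (d j : ℤ)

lemma coeff_quiverSeries (C : Matrix (Fin m) (Fin m) ℤ) (q : ℝ) (d : Fin m →₀ ℕ) :
    MvPowerSeries.coeff d (quiverSeries C q) =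
      (-√q) ^ quadForm C d / ∏ i, qPochhammer q (d i) := rfl

lemma constantCoeff_quiverSeries (C : Matrix (Fin m) (Fin m) ℤ) (q : ℝ) :
    MvPowerSeries.constantCoeff (quiverSeries C q) = 1 := by
  rw [← MvPowerSeries.coeff_zero_eq_constantCoeff_apply, coeff_quiverSeries]
  simp [quadForm, qPochhammer]

lemma quadForm_add_single (C : Matrix (Fin m) (Fin m) ℤ) (hC : C.IsSymm) (d : Fin m → ℕ)
    (i : Fin m) :
    quadForm C (d + Pi.single i 1) = quadForm C d + 2 * (∑ j, C i j * (d j : ℤ)) + C i i := by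
  have h : ∀ f : Fin m → ℤ, ∑ j, f j * ((Pi.single i 1 : Fin m → ℕ) j : ℤ) = f i := by
    intro f
    rw [Finset.sum_eq_single i] <;> simp +contextual
  have h2 : ∀ a, C a i = C i a := fun a => hC.apply i a
  have h3 : ∀ a, ∑ j, C a j * (d a : ℤ) * ((Pi.single i 1 : Fin m → ℕ) j : ℤ) = C a i * d a :=
    fun a => h (fun j => C a j * (d a : ℤ))
  have h4 : ∀ a, ∑ j, C a j * ((Pi.single i 1 : Fin m → ℕ) a : ℤ) * (d j : ℤ) =
      (∑ j, C a j * (d j : ℤ)) * ((Pi.single i 1 : Fin m → ℕ) a : ℤ) := by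
    intro a
    rw [Finset.sum_mul]
    exact Finset.sum_congr rfl fun j _ => by ring
  have h5 : ∀ a, ∑ j, C a j * ((Pi.single i 1 : Fin m → ℕ) a : ℤ) *
      ((Pi.single i 1 : Fin m → ℕ) j : ℤ) = C a i * ((Pi.single i 1 : Fin m → ℕ) a : ℤ) :=
    fun a => h (fun j => C a j * ((Pi.single i 1 : Fin m → ℕ) a : ℤ))
  simp only [quadForm, Pi.add_apply, Nat.cast_add, mul_add, add_mul, Finset.sum_add_distrib,
    h3, h4, h5, h]
  simp only [h2]
  ring

lemma coeff_rescale_zpow {q : ℝ} (hq : 0 < q) (v : Fin m → ℤ) (f : MvPowerSeries (Fin m) ℝ)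
    (d : Fin m →₀ ℕ) :
    MvPowerSeries.coeff d (MvPowerSeries.rescale (fun i => q ^ v i) f) =
      q ^ (∑ i, v i * (d i : ℤ)) * MvPowerSeries.coeff d f := by
  rw [MvPowerSeries.coeff_rescale, Finsupp.prod_fintype _ _ (by simp)]
  congr 1
  have h : ∀ s : Finset (Fin m), q ^ (∑ i ∈ s, v i * (d i : ℤ)) = ∏ i ∈ s, (q ^ v i) ^ d i := by
    intro s
    induction s using Finset.induction_on with
    | empty => simp
    | insert a s ha ih =>
      rw [Finset.sum_insert ha, Finset.prod_insert ha, zpow_add₀ hq.ne', ih, zpow_mul,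
        zpow_natCast]
  exact (h _).symm

/-- The left side has an extra factor `1 - q^{d_i}`, which cancels the last factor of `(q;q)_{d_i}`.
Lowering `d_i` by one changes the quadratic form by `C_ii + 2 (C d)_i`, by symmetry of `C`, and
`(-√q)^2 = q` makes the latter part a shift by the row `C i`. -/
lemma rescale_quiverSeries_sub {C : Matrix (Fin m) (Fin m) ℤ} (hC : C.IsSymm) {q : ℝ} (hq : 0 < q)
    (hq1 : q ≠ 1) (v : Fin m → ℤ) (i : Fin m) :
    MvPowerSeries.rescale (fun j => q ^ v j) (quiverSeries C q) -
      MvPowerSeries.rescale (fun j => q ^ (v + Pi.single i 1 : Fin m → ℤ) j) (quiverSeries C q) =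
    MvPowerSeries.C ((-√q) ^ C i i * q ^ v i) * (MvPowerSeries.X i *
      MvPowerSeries.rescale (fun j => q ^ (v + C i) j) (quiverSeries C q)) := by
  ext d
  rw [map_sub, coeff_rescale_zpow hq, coeff_rescale_zpow hq, MvPowerSeries.coeff_C_mul,
    MvPowerSeries.X_def, MvPowerSeries.coeff_monomial_mul]
  have hs : ∑ j, (v + Pi.single i 1 : Fin m → ℤ) j * (d j : ℤ) = ∑ j, v j * (d j : ℤ) + d i := by
    simp only [Pi.add_apply, add_mul, Finset.sum_add_distrib]
    congr 1
    rw [Finset.sum_eq_single i] <;> simp +contextual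
  rw [hs]
  by_cases hd : d i = 0
  · rw [if_neg (fun h => by simpa [hd] using h i), hd]
    simp
  · have hle : Finsupp.single i 1 ≤ d := by
      rw [Finsupp.single_le_iff]; omega
    rw [if_pos hle, coeff_rescale_zpow hq]
    obtain ⟨e, rfl⟩ : ∃ e, d = e + Finsupp.single i 1 :=
      ⟨d - Finsupp.single i 1, (tsub_add_cancel_of_le hle).symm⟩
    rw [add_tsub_cancel_right, coeff_quiverSeries, coeff_quiverSeries]
    have hco : ⇑(e + Finsupp.single i 1 : Fin m →₀ ℕ) = ⇑e + Pi.single i 1 := by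
      rw [Finsupp.coe_add, Finsupp.single_eq_pi_single]
    rw [hco, quadForm_add_single C hC]
    have hP : ∏ j, qPochhammer q ((⇑e + Pi.single i 1 : Fin m → ℕ) j) =
        (∏ j, qPochhammer q (e j)) * (1 - q ^ (e i + 1)) := by
      rw [← Finset.mul_prod_erase _ _ (Finset.mem_univ i),
        ← Finset.mul_prod_erase (a := i) _ (fun j => qPochhammer q (e j)) (Finset.mem_univ i)]
      have : ∏ j ∈ Finset.univ.erase i, qPochhammer q ((⇑e + Pi.single i 1 : Fin m → ℕ) j) =
          ∏ j ∈ Finset.univ.erase i, qPochhammer q (e j) :=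
        Finset.prod_congr rfl fun j hj => by simp [Finset.ne_of_mem_erase hj]
      rw [this]
      simp only [Pi.add_apply, Pi.single_eq_same, qPochhammer, Finset.prod_range_succ]
      ring
    have hne : ∀ k : ℕ, 1 - q ^ (k + 1) ≠ 0 := fun k h =>
      hq1 ((pow_eq_one_iff_of_nonneg hq.le (Nat.succ_ne_zero k)).mp (sub_eq_zero.mp h).symm)
    have hPne : ∏ j, qPochhammer q (e j) ≠ 0 :=
      Finset.prod_ne_zero_iff.mpr fun j _ => Finset.prod_ne_zero_iff.mpr fun k _ => hne k
    have hs0 : -√q ≠ 0 := by simpa using (Real.sqrt_pos.mpr hq).ne'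
    have hs2 : (-√q) ^ (2 * ∑ j, C i j * (e j : ℤ)) = q ^ (∑ j, C i j * (e j : ℤ)) := by
      rw [zpow_mul]; congr 1
      rw [zpow_ofNat, neg_sq, Real.sq_sqrt hq.le]
    have hsum : ∑ j, v j * (((⇑e + Pi.single i 1 : Fin m → ℕ) j : ℕ) : ℤ) =
        ∑ j, v j * (e j : ℤ) + v i := by
      simp only [Pi.add_apply, Nat.cast_add, mul_add, Finset.sum_add_distrib]
      congr 1
      rw [Finset.sum_eq_single i] <;> simp +contextual
    rw [hP, hsum, zpow_add₀ hs0, zpow_add₀ hs0, hs2]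
    simp only [Pi.add_apply, Pi.single_eq_same, add_mul, Finset.sum_add_distrib,
      zpow_add₀ hq.ne', zpow_natCast]
    have := hne (e i)
    field_simp

lemma shiftQuotient_sub {C : Matrix (Fin m) (Fin m) ℤ} (hC : C.IsSymm) {q : ℝ} (hq : 0 < q)
    (hq1 : q ≠ 1) (v : Fin m → ℤ) (i : Fin m) :
    shiftQuotient C v q - shiftQuotient C (v + Pi.single i 1) q =
    MvPowerSeries.C ((-√q) ^ C i i * q ^ v i) *
      (MvPowerSeries.X i * shiftQuotient C (v + C i) q) := by
  simp only [shiftQuotient, ← sub_mul, rescale_quiverSeries_sub hC hq hq1 v i]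
  ring

lemma shiftQuotient_zero (C : Matrix (Fin m) (Fin m) ℤ) (q : ℝ) : shiftQuotient C 0 q = 1 := by
  have : (fun i => q ^ (0 : Fin m → ℤ) i) = 1 := by ext; simp
  rw [shiftQuotient, this, MvPowerSeries.rescale_one, RingHom.id_apply,
    MvPowerSeries.mul_inv_cancel _ (by simp [constantCoeff_quiverSeries])]

/-- The cocycle identity `P(q^{v+w}x)/P(x) = P(q^{v+w}x)/P(q^w x) · P(q^w x)/P(x)`; it becomes
multiplicativity as `q → 1`. -/
lemma shiftQuotient_add (C : Matrix (Fin m) (Fin m) ℤ) {q : ℝ} (hq : 0 < q) (v w : Fin m → ℤ) :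
    shiftQuotient C (v + w) q =
      MvPowerSeries.rescale (fun i => q ^ w i) (shiftQuotient C v q) * shiftQuotient C w q := by
  have h : (fun i => q ^ (v + w) i) = (fun i => q ^ v i) * (fun i => q ^ w i) := by
    ext i; simp [zpow_add₀ hq.ne']
  have hinv : quiverSeries C q * (quiverSeries C q)⁻¹ = 1 :=
    MvPowerSeries.mul_inv_cancel _ (by simp [constantCoeff_quiverSeries])
  have h2 := congrArg (MvPowerSeries.rescale (fun i => q ^ w i)) hinv
  rw [map_mul, map_one] at h2
  rw [shiftQuotient, shiftQuotient, shiftQuotient, h, MvPowerSeries.rescale_mul,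
    RingHom.comp_apply, map_mul]
  linear_combination (-MvPowerSeries.rescale (fun i => q ^ w i)
    (MvPowerSeries.rescale (fun i => q ^ v i) (quiverSeries C q)) * (quiverSeries C q)⁻¹) * h2

/-- The translations preserving `P` form a subgroup of `ℤ^m`, and it contains the unit vectors. -/
lemma forall_of_add_single_iff {P : (Fin m → ℤ) → Prop} (h0 : P 0)
    (h : ∀ i v, P v ↔ P (v + Pi.single i 1)) (v : Fin m → ℤ) : P v := by
  let S : AddSubgroup (Fin m → ℤ) :=
    { carrier := {w | ∀ v, P v ↔ P (v + w)}
      zero_mem' := fun v => by simp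
      add_mem' := fun {a b} ha hb v => by rw [ha v, hb (v + a), add_assoc]
      neg_mem' := fun {a} ha v => by
        rw [ha (v + -a)]; simp }
  have hv : v = ∑ i, v i • (Pi.single i 1 : Fin m → ℤ) := by
    ext j
    simp [Finset.sum_apply, Pi.single_apply]
  have : v ∈ S := by
    rw [hv]
    exact S.sum_mem fun i _ => S.zsmul_mem (fun w => h i w) _
  have := (this 0).mp h0
  rwa [zero_add] at this

/-- The coefficient of `x^l` in the classical limit of the quotient with shift vector `v`. -/
def limitCoeff (C : Matrix (Fin m) (Fin m) ℤ) (l : Fin m → ℕ) (v : Fin m → ℝ) : ℝ :=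
  (-1) ^ (∑ i, C i i * (l i : ℤ)) * lagrangeCoeff (fun i j => (C i j : ℝ)) l v

lemma limitCoeff_succ (C : Matrix (Fin m) (Fin m) ℤ) (l : Fin m → ℕ) (v : Fin m → ℝ)
    (i : Fin m) :
    limitCoeff C (l + Pi.single i 1) v - limitCoeff C (l + Pi.single i 1) (v + Pi.single i 1) =
      (-1) ^ C i i * limitCoeff C l (v + fun j => (C i j : ℝ)) := by
  have h : ∑ a, C a a * (((l + Pi.single i 1 : Fin m → ℕ) a : ℕ) : ℤ) =
      ∑ a, C a a * (l a : ℤ) + C i i := by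
    simp only [Pi.add_apply, Nat.cast_add, mul_add, Finset.sum_add_distrib]
    congr 1
    rw [Finset.sum_eq_single i] <;> simp +contextual
  simp only [limitCoeff, h, ← mul_sub, lagrangeCoeff_succ]
  rw [zpow_add₀ (by norm_num)]
  ring

lemma eventually_pos_and_ne_one : ∀ᶠ q : ℝ in 𝓝[≠] 1, 0 < q ∧ q ≠ 1 := by
  filter_upwards [self_mem_nhdsWithin, nhdsWithin_le_nhds (lt_mem_nhds one_pos)] with q h1 h2
  exact ⟨h2, h1⟩

/-- Induction on the degree of `l`. For fixed `l` the difference between `v` and `v + e_i` involves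
only a lower degree, so convergence passes between these shifts in both directions, starting from `v
= 0`, where the quotient is `1`. -/
lemma tendsto_coeff_shiftQuotient {C : Matrix (Fin m) (Fin m) ℤ} (hC : C.IsSymm)
    (l : Fin m →₀ ℕ) (v : Fin m → ℤ) :
    Tendsto (fun q : ℝ => MvPowerSeries.coeff l (shiftQuotient C v q)) (𝓝[≠] 1)
      (𝓝 (limitCoeff C l fun i => (v i : ℝ))) := by
  induction hk : l.degree using Nat.strong_induction_on generalizing l v with
  | _ k ih =>
  subst hk
  rcases eq_or_ne l 0 with rfl | hl
  · have : ∀ q : ℝ, MvPowerSeries.coeff 0 (shiftQuotient C v q) = 1 := by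
      intro q
      rw [MvPowerSeries.coeff_zero_eq_constantCoeff_apply, shiftQuotient, map_mul,
        MvPowerSeries.constantCoeff_inv, constantCoeff_quiverSeries,
        ← MvPowerSeries.coeff_zero_eq_constantCoeff_apply, MvPowerSeries.coeff_rescale,
        MvPowerSeries.coeff_zero_eq_constantCoeff_apply, constantCoeff_quiverSeries]
      simp
    simp only [this, limitCoeff, Finsupp.coe_zero, lagrangeCoeff_zero]
    simp
  · have hl' : (⇑l : Fin m → ℕ) ≠ 0 := fun h => hl (DFunLike.coe_injective h)
    revert v
    apply forall_of_add_single_iff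
    · have h1 : (fun i : Fin m => (((0 : Fin m → ℤ) i : ℤ) : ℝ)) = 0 := by ext; simp
      simp only [shiftQuotient_zero, h1, limitCoeff, lagrangeCoeff_at_zero _ _ hl', mul_zero]
      rw [MvPowerSeries.coeff_one, if_neg hl]
      exact tendsto_const_nhds
    · intro i v
      have hcast : (fun j => (((v + Pi.single i 1 : Fin m → ℤ) j : ℤ) : ℝ)) =
          (fun j => (v j : ℝ)) + Pi.single i 1 := by
        ext j
        rcases eq_or_ne j i with rfl | hj <;> simp_all
      suffices hd : Tendsto (fun q : ℝ => MvPowerSeries.coeff l (shiftQuotient C v q) -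
          MvPowerSeries.coeff l (shiftQuotient C (v + Pi.single i 1) q)) (𝓝[≠] 1)
          (𝓝 (limitCoeff C l (fun j => (v j : ℝ)) -
            limitCoeff C l (fun j => (((v + Pi.single i 1 : Fin m → ℤ) j : ℤ) : ℝ)))) by
        constructor
        · intro h
          simpa using h.sub hd
        · intro h
          simpa using h.add hd
      rw [hcast]
      -- If `l_i = 0`, the factor `x_i` kills the right side of the difference equation; otherwise
      -- the induction hypothesis applies to `l - e_i`.
      by_cases hi : l i = 0
      · have h1 : limitCoeff C l ((fun j => (v j : ℝ)) + Pi.single i 1) =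
            limitCoeff C l (fun j => (v j : ℝ)) := by
          simp only [limitCoeff, lagrangeCoeff_add_single_of_eq_zero _ _ _ _ hi]
        rw [h1, sub_self]
        refine tendsto_const_nhds.congr' ?_
        filter_upwards [eventually_pos_and_ne_one] with q hq
        rw [← map_sub, shiftQuotient_sub hC hq.1 hq.2, MvPowerSeries.coeff_C_mul,
          MvPowerSeries.X_def, MvPowerSeries.coeff_monomial_mul,
          if_neg (fun h => by simpa [hi] using h i), mul_zero]
      · have hle : Finsupp.single i 1 ≤ l := by
          rw [Finsupp.single_le_iff]; omega
        obtain ⟨e, rfl⟩ : ∃ e, l = e + Finsupp.single i 1 :=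
          ⟨l - Finsupp.single i 1, (tsub_add_cancel_of_le hle).symm⟩
        have hco : ⇑(e + Finsupp.single i 1 : Fin m →₀ ℕ) = ⇑e + Pi.single i 1 := by
          rw [Finsupp.coe_add, Finsupp.single_eq_pi_single]
        rw [hco, limitCoeff_succ]
        have hcast2 : ((fun j => (v j : ℝ)) + fun j => (C i j : ℝ)) =
            fun j => (((v + C i) j : ℤ) : ℝ) := by ext j; simp
        have hlim := ih e.degree (by simp) e (v + C i) rfl
        rw [hcast2]
        have hs : Tendsto (fun q : ℝ => (-√q) ^ C i i * q ^ v i) (𝓝[≠] 1)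
            (𝓝 ((-1) ^ C i i)) := by
          have hc : ContinuousAt (fun q : ℝ => (-√q) ^ C i i * q ^ v i) 1 := by
            refine ContinuousAt.mul (ContinuousAt.zpow₀ ?_ _ (by simp))
              (continuousAt_zpow₀ _ _ (by simp))
            exact Real.continuous_sqrt.neg.continuousAt
          have := hc.tendsto
          simp only [Real.sqrt_one, one_zpow, mul_one] at this
          exact this.mono_left nhdsWithin_le_nhds
        refine (hs.mul hlim).congr' ?_
        filter_upwards [eventually_pos_and_ne_one] with q hq
        rw [← map_sub, shiftQuotient_sub hC hq.1 hq.2, MvPowerSeries.coeff_C_mul,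
          MvPowerSeries.X_def, MvPowerSeries.coeff_monomial_mul, if_pos hle,
          add_tsub_cancel_right, one_mul]

lemma coeff_classicalLimit {C : Matrix (Fin m) (Fin m) ℤ} (hC : C.IsSymm) (n : Fin m → ℕ)
    (l : Fin m →₀ ℕ) :
    MvPowerSeries.coeff l (classicalLimit C n) = limitCoeff C l fun i => (n i : ℝ) := by
  have h := tendsto_coeff_shiftQuotient hC l (fun i => (n i : ℤ))
  simp only [← quiverQuotient_eq_shiftQuotient, Int.cast_natCast] at h
  exact h.limUnder_eq

lemma tendsto_coeff_quiverQuotient {C : Matrix (Fin m) (Fin m) ℤ} (hC : C.IsSymm) (n : Fin m → ℕ)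
    (l : Fin m →₀ ℕ) :
    Tendsto (fun q : ℝ => MvPowerSeries.coeff l (quiverQuotient C n q)) (𝓝[≠] 1)
      (𝓝 (MvPowerSeries.coeff l (classicalLimit C n))) := by
  have h := tendsto_coeff_shiftQuotient hC l (fun i => (n i : ℤ))
  rw [coeff_classicalLimit hC]
  simpa only [quiverQuotient_eq_shiftQuotient, Int.cast_natCast] using h

lemma constantCoeff_classicalLimit {C : Matrix (Fin m) (Fin m) ℤ} (hC : C.IsSymm)
    (n : Fin m → ℕ) : MvPowerSeries.constantCoeff (classicalLimit C n) = 1 := by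
  rw [← MvPowerSeries.coeff_zero_eq_constantCoeff_apply, coeff_classicalLimit hC]
  simp [limitCoeff]

lemma classicalLimit_zero {C : Matrix (Fin m) (Fin m) ℤ} (hC : C.IsSymm) :
    classicalLimit C 0 = 1 := by
  ext l
  refine tendsto_nhds_unique (tendsto_coeff_quiverQuotient hC 0 l) ?_
  have : ∀ q, quiverQuotient C 0 q = 1 := fun q => by
    rw [quiverQuotient_eq_shiftQuotient]
    exact shiftQuotient_zero C q
  simp only [this]
  exact tendsto_const_nhds

/-- The rescaling in the cocycle identity multiplies each coefficient by a power of `q`, which tends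
to `1`. -/
lemma classicalLimit_add {C : Matrix (Fin m) (Fin m) ℤ} (hC : C.IsSymm) (n k : Fin m → ℕ) :
    classicalLimit C (n + k) = classicalLimit C n * classicalLimit C k := by
  ext l
  refine tendsto_nhds_unique (tendsto_coeff_quiverQuotient hC (n + k) l) ?_
  rw [MvPowerSeries.coeff_mul]
  have key : Tendsto (fun q : ℝ => ∑ p ∈ Finset.HasAntidiagonal.antidiagonal l,
      (q ^ (∑ i, (k i : ℤ) * (p.1 i : ℤ)) * MvPowerSeries.coeff p.1 (quiverQuotient C n q)) *
        MvPowerSeries.coeff p.2 (quiverQuotient C k q)) (𝓝[≠] 1)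
      (𝓝 (∑ p ∈ Finset.HasAntidiagonal.antidiagonal l, MvPowerSeries.coeff p.1 (classicalLimit C n) *
        MvPowerSeries.coeff p.2 (classicalLimit C k))) := by
    refine tendsto_finsetSum _ fun p _ => Tendsto.mul ?_ (tendsto_coeff_quiverQuotient hC k p.2)
    have hz : Tendsto (fun q : ℝ => q ^ (∑ i, (k i : ℤ) * (p.1 i : ℤ))) (𝓝[≠] 1) (𝓝 1) := by
      have := (continuousAt_zpow₀ (1 : ℝ) (∑ i, (k i : ℤ) * (p.1 i : ℤ)) (by simp)).tendsto
      rw [one_zpow] at this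
      exact this.mono_left nhdsWithin_le_nhds
    simpa using hz.mul (tendsto_coeff_quiverQuotient hC n p.1)
  refine key.congr' ?_
  filter_upwards [eventually_pos_and_ne_one] with q hq
  have : quiverQuotient C (n + k) q = MvPowerSeries.rescale (fun i => q ^ (k i : ℤ))
      (quiverQuotient C n q) * quiverQuotient C k q := by
    simp only [quiverQuotient_eq_shiftQuotient]
    rw [← shiftQuotient_add C hq.1]
    congr 1
  rw [this, MvPowerSeries.coeff_mul]
  exact Finset.sum_congr rfl fun p _ => by rw [coeff_rescale_zpow hq.1]

lemma classicalLimit_nsmul {C : Matrix (Fin m) (Fin m) ℤ} (hC : C.IsSymm) (n : Fin m → ℕ) (N : ℕ) :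
    classicalLimit C (N • n) = classicalLimit C n ^ N := by
  induction N with
  | zero => simp [classicalLimit_zero hC]
  | succ N ih => rw [succ_nsmul, classicalLimit_add hC, ih, pow_succ]

end ShiftedQuotient

/-! ### The logarithm as the derivative of powers at exponent zero -/

section LogCoefficient

variable {m : ℕ}

lemma Matrix.derivative_det {R : Type*} [CommRing R] {ι : Type*} [Fintype ι] [DecidableEq ι]
    (A : Matrix ι ι (Polynomial R)) :
    Polynomial.derivative A.det =
      ∑ r, (A.updateRow r fun j => Polynomial.derivative (A r j)).det := by
  -- After transposition the factors of the Leibniz product are indexed by rows.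
  simp only [← Matrix.det_transpose A, ← Matrix.det_transpose (A.updateRow _ _)]
  simp only [Matrix.det_apply', Polynomial.derivative_sum, Polynomial.derivative_intCast_mul,
    Polynomial.derivative_prod_finset, Matrix.transpose_apply]
  rw [Finset.sum_comm]
  refine Finset.sum_congr rfl fun σ _ => ?_
  rw [Finset.mul_sum]
  refine Finset.sum_congr rfl fun r _ => ?_
  rw [← Finset.mul_prod_erase _ _ (Finset.mem_univ r), Matrix.updateRow_self]
  congr 1
  rw [mul_comm]
  congr 1
  exact Finset.prod_congr rfl fun j hj => by rw [Matrix.updateRow_ne (Finset.ne_of_mem_erase hj)]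

variable {R : Type*} [CommRing R] [Algebra ℚ R] {R' : Type*} [CommRing R'] [Algebra ℚ R']

/-- The formula for `c_l` after cancellation, polynomial in the entries of `c` and `n`. -/
def cancelledTerm (c : Fin m → Fin m → R) (n : Fin m → R) (l : Fin m → ℕ) : R :=
  (∏ i, reducedBinom (inflow c l i) (l i)) *
    ∑ r, if l r = 0 then 0 else n r * (flowMatrix c (inflow c l) l).adjugate r r

lemma map_cancelledTerm (φ : R →+* R') (c : Fin m → Fin m → R) (n : Fin m → R) (l : Fin m → ℕ) :
    φ (cancelledTerm c n l) =
      cancelledTerm (fun i j => φ (c i j)) (fun i => φ (n i)) l := by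
  simp only [cancelledTerm, map_mul, map_prod, map_reducedBinom, map_inflow, map_sum]
  congr 1
  refine Finset.sum_congr rfl fun r _ => ?_
  split_ifs
  · simp
  · rw [map_mul]
    congr 1
    have h1 := map_flowMatrix φ c (inflow c l) l
    have h2 := RingHom.map_adjugate φ (flowMatrix c (inflow c l) l)
    have h3 := congrFun (congrFun h2 r) r
    rw [RingHom.mapMatrix_apply, RingHom.mapMatrix_apply, h1, Matrix.map_apply] at h3
    rw [h3]
    simp only [map_inflow]

-- At `0` the determinant vanishes, so the product rule leaves only its derivative. Differentiating
-- row `r` gives `n_r e_r`, or `0` if `l_r = 0`, hence `n_r` times a diagonal cofactor.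
open Polynomial in
lemma derivative_lagrangeCoeff [IsDomain R] (c : Fin m → Fin m → R) (n : Fin m → R)
    (l : Fin m → ℕ) (hl : l ≠ 0) :
    (derivative (lagrangeCoeff (fun i j => Polynomial.C (c i j)) l
      (fun i => Polynomial.C (n i) * X))).eval 0 = (-1) ^ (∑ i, l i) * cancelledTerm c n l := by
  set c' : Fin m → Fin m → R[X] := fun i j => Polynomial.C (c i j)
  set Z : Fin m → R[X] := fun i => Polynomial.C (n i) * X + inflow c' l i
  have hc' : (fun i j => evalRingHom 0 (c' i j)) = c := by
    ext i j; simp [c']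
  have hin : ∀ i, evalRingHom 0 (inflow c' l i) = inflow c l i := fun i => by
    rw [map_inflow, hc']
  have hZ : (fun i => evalRingHom 0 (Z i)) = inflow c l := by
    ext i
    simp only [Z, map_add, hin]
    simp
  have hmap : (flowMatrix c' Z l).map (evalRingHom 0) = flowMatrix c (inflow c l) l := by
    rw [map_flowMatrix, hc', hZ]
  have hdet : eval 0 (flowMatrix c' Z l).det = 0 := by
    rw [← coe_evalRingHom, RingHom.map_det, RingHom.mapMatrix_apply, hmap,
      det_flowMatrix_inflow c l hl]
  have hdZ : ∀ i, derivative (Z i) = Polynomial.C (n i) := fun i => by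
    simp [Z, inflow, c']
  have hrow : ∀ r, evalRingHom 0 ((flowMatrix c' Z l).updateRow r
      fun j => derivative (flowMatrix c' Z l r j)).det =
      if l r = 0 then 0 else n r * (flowMatrix c (inflow c l) l).adjugate r r := by
    intro r
    rw [RingHom.map_det, RingHom.mapMatrix_apply]
    have : ((flowMatrix c' Z l).updateRow r
        fun j => derivative (flowMatrix c' Z l r j)).map (evalRingHom 0) =
        (flowMatrix c (inflow c l) l).updateRow r
          ((if l r = 0 then 0 else n r) • Pi.single r 1) := by
      rw [Matrix.map_updateRow, hmap]
      congr 1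
      ext j
      by_cases h : l r = 0
      · by_cases hj : r = j <;> [subst hj; skip] <;> simp [flowMatrix, *]
      · rcases eq_or_ne r j with rfl | hj
        · simp [flowMatrix, h, hdZ, c']
        · simp [flowMatrix, h, hj, c', hj.symm]
    rw [this, Matrix.det_updateRow_smul, Matrix.adjugate_apply]
    split_ifs <;> simp
  have hpr : eval 0 (∏ i, reducedBinom (Z i) (l i)) =
      ∏ i, reducedBinom (inflow c l i) (l i) := by
    rw [← coe_evalRingHom, map_prod]
    refine Finset.prod_congr rfl fun i _ => ?_
    rw [map_reducedBinom, ← congrFun hZ i]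
  have hsign : ((-1 : R[X]) ^ (∑ i, l i)) = Polynomial.C ((-1) ^ (∑ i, l i)) := by simp
  rw [lagrangeCoeff, hsign, derivative_C_mul, eval_C_mul, flowDet, derivative_mul, eval_add,
    eval_mul, eval_mul, hdet, mul_zero, zero_add, hpr, Matrix.derivative_det]
  congr 2
  rw [← coe_evalRingHom, map_sum]
  exact Finset.sum_congr rfl fun r _ => hrow r

lemma eval_neg_one_descPochhammer (k : ℕ) :
    (descPochhammer ℝ k).eval (-1) = (-1) ^ k * (k.factorial : ℝ) := by
  induction k with
  | zero => simp
  | succ k ih =>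
    rw [descPochhammer_succ_eval, ih, Nat.factorial_succ]
    push_cast
    ring

/-- The derivative of `binom(N, k)` at `N = 0` is the `k`-th coefficient of `log (1 + X)`. -/
lemma derivative_descPochhammer_eval_zero (k : ℕ) :
    (Polynomial.derivative (descPochhammer ℝ k)).eval 0 / k.factorial =
      if k = 0 then 0 else (-1) ^ (k + 1) / (k : ℝ) := by
  rcases k with _ | k
  · simp
  · rw [descPochhammer_succ_left, Polynomial.derivative_mul]
    have : ((k.factorial : ℕ) : ℝ) ≠ 0 := by positivity
    simp [Polynomial.eval_comp, eval_neg_one_descPochhammer, Nat.factorial_succ]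
    field_simp
    ring

lemma hasSubst_sub_one {f : MvPowerSeries (Fin m) ℝ} (hf : MvPowerSeries.constantCoeff f = 1) :
    PowerSeries.HasSubst (f - 1) :=
  PowerSeries.HasSubst.of_constantCoeff_zero (by simp [hf])

lemma coeff_mvLog {f : MvPowerSeries (Fin m) ℝ} (hf : MvPowerSeries.constantCoeff f = 1)
    (l : Fin m →₀ ℕ) :
    MvPowerSeries.coeff l (mvLog f) = ∑ k ∈ Finset.range (l.degree + 1),
      (if k = 0 then 0 else (-1) ^ (k + 1) / (k : ℝ)) * MvPowerSeries.coeff l ((f - 1) ^ k) := by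
  rw [mvLog, PowerSeries.coeff_subst (hasSubst_sub_one hf)]
  rw [finsum_eq_sum_of_support_subset (s := Finset.range (l.degree + 1))]
  · refine Finset.sum_congr rfl fun k _ => ?_
    rw [PowerSeries.coeff_log, smul_eq_mul]
    congr 1
    split_ifs <;> simp
  · intro k hk
    by_contra h
    simp only [Finset.coe_range, Set.mem_Iio, not_lt] at h
    refine hk ?_
    have : MvPowerSeries.coeff l ((f - 1) ^ k) = 0 :=
      MvPowerSeries.coeff_eq_zero_of_constantCoeff_nilpotent (m := 1) (by simp [hf]) (by omega)
    simp [this]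

/-- The binomial expansion of `(1 + (f - 1))^N`, truncated because `(f - 1)^k` has no terms of
degree below `k`; each coefficient is thus polynomial in `N`. -/
lemma coeff_pow_eq_eval {f : MvPowerSeries (Fin m) ℝ} (hf : MvPowerSeries.constantCoeff f = 1)
    (l : Fin m →₀ ℕ) (N : ℕ) :
    MvPowerSeries.coeff l (f ^ N) = (∑ k ∈ Finset.range (l.degree + 1),
      Polynomial.C (MvPowerSeries.coeff l ((f - 1) ^ k) / (k.factorial : ℝ)) *
        descPochhammer ℝ k).eval (N : ℝ) := by
  have h1 : f ^ N = ∑ k ∈ Finset.range (N + 1), (f - 1) ^ k * (N.choose k : MvPowerSeries _ ℝ) := by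
    conv_lhs => rw [← sub_add_cancel f 1, add_pow]
    simp
  have h2 : ∀ k, MvPowerSeries.coeff l ((f - 1) ^ k * (N.choose k : MvPowerSeries _ ℝ)) =
      MvPowerSeries.coeff l ((f - 1) ^ k) * (N.choose k : ℝ) := fun k => by
    rw [← map_natCast (MvPowerSeries.C (σ := Fin m) (R := ℝ)), MvPowerSeries.coeff_mul_C]
  have h3 : ∀ k, l.degree < k → MvPowerSeries.coeff l ((f - 1) ^ k) = 0 := fun k hk =>
    MvPowerSeries.coeff_eq_zero_of_constantCoeff_nilpotent (m := 1) (by simp [hf]) (by omega)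
  rw [h1, map_sum, Polynomial.eval_finsetSum]
  simp only [h2, Polynomial.eval_mul, Polynomial.eval_C, descPochhammer_eval_eq_descFactorial]
  have h4 : ∀ k, MvPowerSeries.coeff l ((f - 1) ^ k) / (k.factorial : ℝ) *
      (N.descFactorial k : ℝ) = MvPowerSeries.coeff l ((f - 1) ^ k) * (N.choose k : ℝ) := by
    intro k
    rw [Nat.descFactorial_eq_factorial_mul_choose]
    have : (k.factorial : ℝ) ≠ 0 := by positivity
    push_cast
    field_simp
  simp only [h4]
  trans ∑ k ∈ Finset.range (max (N + 1) (l.degree + 1)),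
    MvPowerSeries.coeff l ((f - 1) ^ k) * (N.choose k : ℝ)
  · refine Finset.sum_subset (Finset.range_mono (le_max_left _ _)) fun k _ hk => ?_
    rw [Nat.choose_eq_zero_of_lt (by simpa using hk)]
    simp
  · refine (Finset.sum_subset (Finset.range_mono (le_max_right _ _)) fun k _ hk => ?_).symm
    rw [h3 k (by simpa using hk), zero_mul]

/-- Two polynomials in `N` give the coefficient of `y^N`: the binomial one and the determinantal one
at shift `N n`. They agree at all naturals, so their derivatives at `0` agree. -/
lemma coeff_mvLog_classicalLimit {C : Matrix (Fin m) (Fin m) ℤ} (hC : C.IsSymm) (n : Fin m → ℕ)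
    (l : Fin m →₀ ℕ) (hl : l ≠ 0) :
    MvPowerSeries.coeff l (mvLog (classicalLimit C n)) =
      (-1 : ℝ) ^ (∑ i, (C i i + 1) * (l i : ℤ)) *
        cancelledTerm (fun i j => (C i j : ℝ)) (fun i => (n i : ℝ)) l := by
  have hl' : (⇑l : Fin m → ℕ) ≠ 0 := fun h => hl (DFunLike.coe_injective h)
  have hy := constantCoeff_classicalLimit hC n
  set p₁ : Polynomial ℝ := ∑ k ∈ Finset.range (l.degree + 1),
      Polynomial.C (MvPowerSeries.coeff l ((classicalLimit C n - 1) ^ k) / (k.factorial : ℝ)) *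
        descPochhammer ℝ k with hp₁
  set p₂ : Polynomial ℝ := Polynomial.C ((-1) ^ (∑ i, C i i * (l i : ℤ))) *
    lagrangeCoeff (fun i j => Polynomial.C (C i j : ℝ)) l
      (fun i => Polynomial.C (n i : ℝ) * Polynomial.X) with hp₂
  have heval : ∀ N : ℕ, p₁.eval (N : ℝ) = p₂.eval (N : ℝ) := by
    intro N
    rw [hp₁, ← coeff_pow_eq_eval hy, ← classicalLimit_nsmul hC, coeff_classicalLimit hC, hp₂,
      Polynomial.eval_C_mul, limitCoeff, ← Polynomial.coe_evalRingHom, map_lagrangeCoeff]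
    congr 2
    · simp
    · ext i; simp [mul_comm]
  have hpp : p₁ = p₂ := Polynomial.eq_of_infinite_eval_eq _ _
    (Set.infinite_of_injective_forall_mem Nat.cast_injective heval)
  have hd := congrArg (fun p => (Polynomial.derivative p).eval 0) hpp
  simp only [hp₂, Polynomial.derivative_C_mul, Polynomial.eval_C_mul] at hd
  rw [derivative_lagrangeCoeff _ _ _ hl', ← mul_assoc] at hd
  rw [coeff_mvLog hy]
  have hsign : (-1 : ℝ) ^ (∑ i, C i i * (l i : ℤ)) * (-1) ^ (∑ i, l i) =
      (-1) ^ (∑ i, (C i i + 1) * (l i : ℤ)) := by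
    simp only [add_mul, one_mul, Finset.sum_add_distrib]
    rw [zpow_add₀ (by norm_num), ← Nat.cast_sum, zpow_natCast]
  rw [← hsign, ← hd, hp₁, Polynomial.derivative_sum, Polynomial.eval_finsetSum]
  refine Finset.sum_congr rfl fun k _ => ?_
  rw [Polynomial.derivative_C_mul, Polynomial.eval_C_mul, ← derivative_descPochhammer_eval_zero]
  ring

end LogCoefficient

/-! ### The weighted matrix-forest theorem -/

section MatrixForest

variable {ι : Type*} [Fintype ι] [DecidableEq ι] {R : Type*} [CommRing R]

/-- A parent function (with value `none` at the roots) without cycles. -/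
def IsForest (f : ι → Option ι) : Prop :=
  ∀ i, ¬ Relation.TransGen (fun a b => f b = some a) i i

/-- The vector `e_j - e_i` for `o = some i`, and `e_j` for `o = none`. -/
def edgeVector (R : Type*) [CommRing R] (j : ι) (o : Option ι) : ι → R :=
  fun k => (if j = k then 1 else 0) - (if o = some k then 1 else 0)

/-- The indicator of everything reachable from a vertex `i` on a cycle lies in the kernel: a vertex
is reachable exactly when its parent is (for `i` itself because of the cycle), and no root is
reachable. -/
lemma det_edgeVector_of_not_isForest [IsDomain R] {f : ι → Option ι} (hf : ¬ IsForest f) :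
    (Matrix.of fun j => edgeVector R j (f j)).det = 0 := by
  classical
  obtain ⟨i, hi⟩ : ∃ i, Relation.TransGen (fun a b => f b = some a) i i := by
    simpa [IsForest] using hf
  obtain ⟨p, hip, hp⟩ := Relation.TransGen.tail'_iff.mp hi
  rw [← Matrix.exists_mulVec_eq_zero_iff]
  refine ⟨fun j => if Relation.ReflTransGen (fun a b => f b = some a) i j then 1 else 0,
    Function.ne_iff.mpr ⟨i, by simp [Relation.ReflTransGen.refl]⟩, ?_⟩
  ext j
  have hs : ∀ o : Option ι, o = f j → (∑ k, edgeVector R j o k *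
      (if Relation.ReflTransGen (fun a b => f b = some a) i k then 1 else 0)) = 0 := by
    intro o ho
    simp only [edgeVector, sub_mul, Finset.sum_sub_distrib, ite_mul, one_mul, zero_mul,
      Finset.sum_ite_eq, Finset.mem_univ, if_true]
    rcases o with _ | a
    · simp only [reduceCtorEq, if_false, Finset.sum_const_zero, sub_zero, ite_eq_right_iff,
        one_ne_zero, imp_false]
      intro h
      rcases h.cases_tail with rfl | ⟨b, -, hb⟩
      · rw [← ho] at hp; cases hp
      · rw [← ho] at hb; cases hb
    · simp only [Option.some.injEq, Finset.sum_ite_eq, Finset.mem_univ, if_true]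
      have : Relation.ReflTransGen (fun a b => f b = some a) i j ↔
          Relation.ReflTransGen (fun a b => f b = some a) i a := by
        constructor
        · intro h
          rcases h.cases_tail with rfl | ⟨b, hb, hbj⟩
          · rw [← ho] at hp; cases hp; exact hip
          · rw [← ho] at hbj; cases hbj; exact hb
        · intro h
          exact h.tail ho.symm
      simp [this]
  exact hs (f j) rfl

/-- Ordered by the number of ancestors, the matrix is unitriangular. -/
lemma det_edgeVector_of_isForest {f : ι → Option ι} (hf : IsForest f) :
    (Matrix.of fun j => edgeVector R j (f j)).det = 1 := by
  classical
  let anc : ι → Finset ι := fun j =>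
    Finset.univ.filter fun a => Relation.TransGen (fun a b => f b = some a) a j
  have hlt : ∀ i j, f i = some j → (anc j).card < (anc i).card := by
    intro i j h
    refine Finset.card_lt_card (Finset.ssubset_iff_of_subset ?_ |>.mpr ⟨j, ?_, ?_⟩)
    · intro a ha
      simp only [anc, Finset.mem_filter, Finset.mem_univ, true_and] at ha ⊢
      exact ha.tail h
    · simp only [anc, Finset.mem_filter, Finset.mem_univ, true_and]
      exact Relation.TransGen.single h
    · simpa [anc] using hf j
  -- The order is reversed because off-diagonal entries sit at the parent, which has fewer
  -- ancestors, while block triangularity excludes columns of smaller value.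
  let b : ι → ℕᵒᵈ := fun j => OrderDual.toDual (anc j).card
  have hb : (Matrix.of fun j => edgeVector R j (f j)).BlockTriangular b := by
    intro i j hij
    have hij' : (anc i).card < (anc j).card := hij
    have h1 : i ≠ j := by rintro rfl; exact lt_irrefl _ hij'
    have h2 : f i ≠ some j := fun h => lt_asymm hij' (hlt i j h)
    simp [edgeVector, h1, h2]
  rw [hb.det]
  refine Finset.prod_eq_one fun k _ => ?_
  have : (Matrix.of fun j => edgeVector R j (f j)).toSquareBlock b k = 1 := by
    ext ⟨i, hi⟩ ⟨j, hj⟩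
    have h2 : f i ≠ some j := fun h => by
      have := hlt i j h
      have e : b i = b j := hi.trans hj.symm
      exact this.ne' e
    simp [Matrix.toSquareBlock_def, edgeVector, h2, Matrix.one_apply]
  rw [this, Matrix.det_one]

open Classical in
/-- The weighted matrix-forest theorem. -/
lemma det_sum_edgeVector [IsDomain R] (W : ι → Option ι → R) :
    (Matrix.of fun j => ∑ o, W j o • edgeVector R j o).det =
      ∑ f : ι → Option ι, if IsForest f then ∏ j, W j (f j) else 0 := by
  -- Multilinear expansion chooses a parent, or none, for each row.
  have h := (Matrix.detRowAlternating (R := R) (n := ι)).toMultilinearMap.map_sum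
    (fun j (o : Option ι) => W j o • edgeVector R j o)
  refine h.trans (Finset.sum_congr rfl fun f _ => ?_)
  rw [MultilinearMap.map_smul_univ]
  change (∏ j, W j (f j)) • (Matrix.of fun j => edgeVector R j (f j)).det = _
  split_ifs with hf
  · rw [det_edgeVector_of_isForest hf, smul_eq_mul, mul_one]
  · rw [det_edgeVector_of_not_isForest hf, smul_zero]

end MatrixForest

/-! ### `A_max` as a sum of cofactors -/

section Arborescence

variable {m : ℕ}

/-- The set of pairs `(i, j)` with `i` the parent of `j`. -/
def parentPairs (f : Fin m → Option (Fin m)) : Finset (Fin m × Fin m) :=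
  Finset.univ.filter fun p => f p.2 = some p.1

lemma mem_parentPairs {f : Fin m → Option (Fin m)} {p : Fin m × Fin m} :
    p ∈ parentPairs f ↔ f p.2 = some p.1 := by simp [parentPairs]

lemma prod_parentPairs {K : Type*} [CommMonoid K] (f : Fin m → Option (Fin m))
    (h : Fin m → Fin m → K) :
    ∏ p ∈ parentPairs f, h p.1 p.2 = ∏ j, (f j).elim 1 fun i => h i j := by
  rw [parentPairs, Finset.prod_filter, Fintype.prod_prod_type_right]
  refine Finset.prod_congr rfl fun j _ => ?_
  rcases hfj : f j with _ | i
  · simp [hfj]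
  · rw [Option.elim_some, Finset.prod_eq_single i]
    · simp [hfj]
    · intro b _ hb
      simp [hfj, hb.symm]
    · simp

lemma card_parentPairs (f : Fin m → Option (Fin m)) :
    (parentPairs f).card + (Finset.univ.filter fun j => f j = none).card = m := by
  have h : (parentPairs f).card = (Finset.univ.filter fun j => ¬ f j = none).card := by
    refine Finset.card_nbij Prod.snd ?_ ?_ ?_
    · intro p hp
      simp [mem_parentPairs.mp hp]
    · intro p hp p' hp' h
      have h1 := mem_parentPairs.mp hp
      have h2 := mem_parentPairs.mp hp'
      rw [h, h2] at h1
      exact Prod.ext (Option.some.inj h1).symm h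
    · intro j hj
      obtain ⟨i, hi⟩ := Option.ne_none_iff_exists'.mp (by simpa using hj)
      exact ⟨(i, j), mem_parentPairs.mpr hi, rfl⟩
  rw [h, add_comm, Finset.card_filter_add_card_filter_not]
  simp

-- An admissible set is the edge set of a unique acyclic parent function, and `m - 1` edges mean
-- exactly one root. For `m = 0` the truncated subtraction would break this count.
open Classical in
lemma sum_admissible_eq {K : Type*} [AddCommMonoid K] (hm : 0 < m)
    (g : Finset (Fin m × Fin m) → K) :
    ∑ S ∈ (Finset.univ.powersetCard (m - 1)).filter IsAdmissible, g S =
      ∑ f : Fin m → Option (Fin m), if IsForest f then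
        (if (Finset.univ.filter fun j => f j = none).card = 1 then g (parentPairs f) else 0)
        else 0 := by
  simp only [← ite_and]
  rw [← Finset.sum_filter]
  symm
  refine Finset.sum_nbij parentPairs ?_ ?_ ?_ fun _ _ => rfl
  · intro f hf
    simp only [Finset.mem_filter, Finset.mem_univ, true_and, Finset.mem_powersetCard,
      Finset.subset_univ] at hf ⊢
    have := card_parentPairs f
    refine ⟨by omega, ?_, ?_⟩
    · intro p hp p' hp' h
      have h1 := mem_parentPairs.mp hp
      have h2 := mem_parentPairs.mp hp'
      rw [h, h2] at h1
      exact Prod.ext (Option.some.inj h1).symm h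
    · intro i hi
      refine hf.1 i ?_
      simpa only [mem_parentPairs] using hi
  · intro f _ f' _ h
    ext j i
    have := Finset.ext_iff.mp h (i, j)
    simpa only [mem_parentPairs, ← Option.mem_def] using this
  · intro S hS
    simp only [Finset.coe_filter, Finset.mem_powersetCard, Finset.subset_univ, true_and,
      Set.mem_ofPred_eq] at hS
    obtain ⟨hcard, huniq, hacyc⟩ := hS
    let f : Fin m → Option (Fin m) := fun j =>
      if h : ∃ i, (i, j) ∈ S then some h.choose else none
    have hf : ∀ i j, f j = some i ↔ (i, j) ∈ S := by
      intro i j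
      by_cases h : ∃ i, (i, j) ∈ S
      · simp only [f, dif_pos h, Option.some.injEq]
        constructor
        · rintro rfl; exact h.choose_spec
        · intro hi
          exact congrArg Prod.fst (huniq _ h.choose_spec _ hi rfl)
      · simp only [f, dif_neg h, reduceCtorEq, false_iff]
        exact fun hi => h ⟨i, hi⟩
    have hS : parentPairs f = S := by
      ext p
      rw [mem_parentPairs, hf]
    refine ⟨f, ?_, hS⟩
    have := card_parentPairs f
    rw [hS, hcard] at this
    simp only [Finset.coe_filter, Finset.mem_univ, true_and, Set.mem_ofPred_eq]
    refine ⟨fun i hi => hacyc i ?_, by omega⟩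
    simpa only [hf] using hi

variable {K : Type*} [Field K]

/-- Each non-root `j` carries a factor `n_j⁻¹`, so of the prefactor `n_1 ⋯ n_m` only the root's
level remains. -/
lemma Amax_eq_sum_forest (hm : 0 < m) (c : Fin m → Fin m → K) (n : Fin m → K)
    (hn : ∀ j, n j ≠ 0) (l : Fin m → ℕ) :
    open Classical in
    Amax c n l = ∑ f : Fin m → Option (Fin m), if IsForest f then
      (if (Finset.univ.filter fun j => f j = none).card = 1 then
        ∏ j, (f j).elim (n j) (fun i => c i j * (l i : K)) else 0) else 0 := by
  classical
  rw [Amax, sum_admissible_eq hm, Finset.mul_sum]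
  refine Finset.sum_congr rfl fun f _ => ?_
  rw [mul_ite, mul_ite, mul_zero,
    prod_parentPairs f (fun i j => c i j * (l i : K) * (n j)⁻¹), ← Finset.prod_mul_distrib]
  congr 2
  refine Finset.prod_congr rfl fun j _ => ?_
  have := hn j
  rcases f j with _ | i
  · simp
  · simp only [Option.elim_some]
    field_simp

/-- The matrix `X_i δ_{ij} - c_{ij} l_i`, whose columns sum to zero. -/
def laplacian (c : Fin m → Fin m → K) (l : Fin m → ℕ) : Matrix (Fin m) (Fin m) K :=
  Matrix.of fun i j => (if i = j then inflow c l i else 0) - c i j * (l i : K)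

lemma det_laplacian (hm : 0 < m) (c : Fin m → Fin m → K) (l : Fin m → ℕ) :
    (laplacian c l).det = 0 := by
  rw [← Matrix.exists_vecMul_eq_zero_iff]
  refine ⟨1, Function.ne_iff.mpr ⟨⟨0, hm⟩, by simp⟩, ?_⟩
  ext j
  simp [Matrix.vecMul, dotProduct, laplacian, inflow]

/-- Row `j` of the transpose is `∑_i c_ij l_i (e_j - e_i)`, a combination of edge vectors. The
cofactor replaces row `r` by `e_r`, the edge vector of a root. -/
lemma adjugate_laplacian (c : Fin m → Fin m → K) (l : Fin m → ℕ) (r : Fin m) :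
    open Classical in
    (laplacian c l).adjugate r r = ∑ f : Fin m → Option (Fin m), if IsForest f then
      ∏ j, (f j).elim (if j = r then 1 else 0)
        (fun i => if j = r then 0 else c i j * (l i : K)) else 0 := by
  classical
  rw [← det_sum_edgeVector (fun j o => o.elim (if j = r then 1 else 0)
        (fun i => if j = r then 0 else c i j * (l i : K)))]
  have ht : (laplacian c l).adjugate r r = (laplacian c l).transpose.adjugate r r := by
    rw [← Matrix.adjugate_transpose, Matrix.transpose_apply]
  rw [ht, Matrix.adjugate_apply]
  congr 1
  ext j k
  simp only [Matrix.of_apply, Fintype.sum_option, Option.elim_none, Option.elim_some,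
    Pi.add_apply, Finset.sum_apply, Pi.smul_apply, smul_eq_mul, edgeVector]
  rcases eq_or_ne j r with rfl | hj
  · simp [Pi.single_apply, eq_comm]
  · rw [Matrix.updateRow_ne hj]
    simp [hj, laplacian, inflow, mul_sub, Finset.sum_sub_distrib]
    by_cases hjk : j = k
    · simp [hjk]
    · simp [hjk, Ne.symm hjk]

lemma Amax_eq_sum_adjugate (hm : 0 < m) (c : Fin m → Fin m → K) (n : Fin m → K)
    (hn : ∀ j, n j ≠ 0) (l : Fin m → ℕ) :
    Amax c n l = ∑ r, n r * (laplacian c l).adjugate r r := by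
  classical
  rw [Amax_eq_sum_forest hm c n hn]
  simp only [adjugate_laplacian, Finset.mul_sum]
  rw [Finset.sum_comm]
  refine Finset.sum_congr rfl fun f _ => ?_
  split_ifs with hf h1
  · obtain ⟨r, hr⟩ := Finset.card_eq_one.mp h1
    have hnone : ∀ j, f j = none ↔ j = r := fun j => by
      simpa using Finset.ext_iff.mp hr j
    rw [Finset.sum_eq_single r]
    · rw [← Finset.mul_prod_erase _ _ (Finset.mem_univ r),
        ← Finset.mul_prod_erase _ (fun j => (f j).elim (if j = r then (1 : K) else 0) _)
          (Finset.mem_univ r), (hnone r).mpr rfl]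
      simp only [Option.elim_none, if_true, one_mul]
      congr 1
      refine Finset.prod_congr rfl fun j hj => ?_
      have hjr := Finset.ne_of_mem_erase hj
      obtain ⟨i, hi⟩ := Option.ne_none_iff_exists'.mp (fun h => hjr ((hnone j).mp h))
      simp [hi, hjr]
    · intro s _ hs
      obtain ⟨i, hi⟩ := Option.ne_none_iff_exists'.mp (fun h => hs ((hnone s).mp h))
      rw [Finset.prod_eq_zero (Finset.mem_univ s) (by simp [hi]), mul_zero]
    · simp
  · symm
    refine Finset.sum_eq_zero fun r _ => ?_
    rcases hfr : f r with _ | i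
    · obtain ⟨j, hj, hjr⟩ : ∃ j, f j = none ∧ j ≠ r := by
        by_contra hcon
        push Not at hcon
        refine h1 (Finset.card_eq_one.mpr ⟨r, ?_⟩)
        ext j
        simp only [Finset.mem_filter, Finset.mem_univ, true_and, Finset.mem_singleton]
        exact ⟨hcon j, fun h => h ▸ hfr⟩
      rw [Finset.prod_eq_zero (Finset.mem_univ j) (by simp [hj, hjr]), mul_zero]
    · rw [Finset.prod_eq_zero (Finset.mem_univ r) (by simp [hfr]), mul_zero]
  · simp

lemma binom_eq_mul_reducedBinom [Algebra ℚ K] (Z : K) {k : ℕ} (hk : k ≠ 0) :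
    binom Z k = Z * reducedBinom Z k := by
  obtain ⟨k, rfl⟩ := Nat.exists_eq_succ_of_ne_zero hk
  rw [binom, reducedBinom, Finset.prod_range_succ', map_inv₀, map_natCast]
  simp only [Nat.succ_eq_add_one, Nat.add_sub_cancel, Nat.cast_zero, sub_zero, Nat.cast_add,
    Nat.cast_one]
  ring

/-- A row with `l_i = 0` is `X_i e_i`, so `X_i` factors out. If `l_r = 0`, then `X_r` times the
cofactor is the determinant of the Laplacian, which is zero. -/
lemma adjugate_laplacian_eq (c : Fin m → Fin m → K) (l : Fin m → ℕ) (hX : ∀ j, inflow c l j ≠ 0)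
    (r : Fin m) :
    (laplacian c l).adjugate r r = (∏ i, if l i = 0 then inflow c l i else 1) *
      if l r = 0 then 0 else (flowMatrix c (inflow c l) l).adjugate r r := by
  have hm : 0 < m := r.pos
  split_ifs with hr
  · have hrow : laplacian c l = (laplacian c l).updateRow r (inflow c l r • Pi.single r 1) := by
      ext i j
      rcases eq_or_ne i r with rfl | hi
      · simp [laplacian, hr, Pi.single_apply, eq_comm]
      · rw [Matrix.updateRow_ne hi]
    have h := det_laplacian hm c l
    rw [hrow, Matrix.det_updateRow_smul, ← Matrix.adjugate_apply] at h
    rw [mul_zero]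
    exact (mul_eq_zero.mp h).resolve_left (hX r)
  · rw [Matrix.adjugate_apply, Matrix.adjugate_apply, ← Matrix.det_mul_column]
    congr 1
    ext i j
    rcases eq_or_ne i r with rfl | hi
    · simp [hr]
    · rw [Matrix.of_apply, Matrix.updateRow_ne hi, Matrix.updateRow_ne hi]
      by_cases h : l i = 0 <;> simp [laplacian, flowMatrix, h]

/-- For `l_i ≠ 0` the factor `1/X_i` cancels inside the binomial; for `l_i = 0` it cancels the `X_i`
extracted from the cofactors. -/
lemma logTerm_eq_cancelledTerm [Algebra ℚ K] (c : Fin m → Fin m → K) (n : Fin m → K) (l : Fin m → ℕ)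
    (hl : l ≠ 0) (hn : ∀ j, n j ≠ 0) (hX : ∀ j, inflow c l j ≠ 0) :
    logTerm c n l = cancelledTerm c n l := by
  have hm : 0 < m := by
    obtain ⟨i, -⟩ := Function.ne_iff.mp hl
    exact i.pos
  have hprod : (∏ i, if l i = 0 then inflow c l i else 1) *
      ∏ j, (1 / inflow c l j) * binom (inflow c l j) (l j) =
      ∏ i, reducedBinom (inflow c l i) (l i) := by
    rw [← Finset.prod_mul_distrib]
    refine Finset.prod_congr rfl fun j _ => ?_
    have := hX j
    split_ifs with h
    · simp [h, binom, this]
    · rw [binom_eq_mul_reducedBinom _ h]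
      field_simp
  rw [cancelledTerm, ← hprod, logTerm, Amax_eq_sum_adjugate hm c n hn]
  simp only [adjugate_laplacian_eq c l hX]
  have : ∑ r, n r * ((∏ i, if l i = 0 then inflow c l i else 1) *
      if l r = 0 then 0 else (flowMatrix c (inflow c l) l).adjugate r r) =
      (∏ i, if l i = 0 then inflow c l i else 1) * ∑ r, if l r = 0 then 0 else
        n r * (flowMatrix c (inflow c l) l).adjugate r r := by
    rw [Finset.mul_sum]
    refine Finset.sum_congr rfl fun r _ => ?_
    split_ifs <;> ring
  rw [this]
  simp only [inflow]
  ring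

end Arborescence

/-! ### The value of the rational function -/

section RationalFunction

variable {m : ℕ}

/-- Over the function field no denominator vanishes, so the cancelled form applies; it is a
polynomial, and the denominator can be taken to be `1`. -/
lemma hasValueAt_logTermRat (C : Matrix (Fin m) (Fin m) ℤ) (n : Fin m → ℕ) (l : Fin m → ℕ)
    (hl : l ≠ 0) :
    HasValueAt (logTermRat l) (parPoint C n)
      (cancelledTerm (fun i j => (C i j : ℝ)) (fun i => (n i : ℝ)) l) := by
  have hinj := IsFractionRing.injective (MvPolynomial (Par m) ℚ) (ParField m)
  let cX : Fin m → Fin m → MvPolynomial (Par m) ℚ := fun i j => MvPolynomial.X (Sum.inl (i, j))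
  let nX : Fin m → MvPolynomial (Par m) ℚ := fun j => MvPolynomial.X (Sum.inr j)
  refine ⟨cancelledTerm cX nX l, 1, by simp, ?_, ?_⟩
  · rw [logTermRat, logTerm_eq_cancelledTerm _ _ _ hl, map_one, div_one, map_cancelledTerm]
    · rfl
    · intro j h
      exact MvPolynomial.X_ne_zero (Sum.inr j) (hinj (by rw [map_zero]; exact h))
    · intro j h
      have h1 : algebraMap (MvPolynomial (Par m) ℚ) (ParField m) (inflow cX l j) = 0 := by
        rw [map_inflow]; exact h
      have h2 : inflow cX l j = 0 := hinj (by rw [h1, map_zero])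
      obtain ⟨i, hi⟩ := Function.ne_iff.mp hl
      -- Setting `C_ij = 1` and all other indeterminates to `0` sends the inflow to `l_i ≠ 0`.
      have h3 := congrArg (MvPolynomial.aeval (R := ℚ)
        (fun s : Par m => if s = Sum.inl (i, j) then (1 : ℚ) else 0)) h2
      simp only [inflow, cX, map_sum, map_mul, MvPolynomial.aeval_X, map_natCast, map_zero,
        Sum.inl.injEq, Prod.mk.injEq, and_true, ite_mul, one_mul, zero_mul, Finset.sum_ite_eq',
        Finset.mem_univ, if_true] at h3
      exact hi (by exact_mod_cast h3)
  · rw [map_one, div_one]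
    have := map_cancelledTerm (MvPolynomial.aeval (R := ℚ) (parPoint C n)).toRingHom cX nX l
    refine Eq.trans ?_ this.symm
    simp [cX, nX, parPoint]

end RationalFunction

/-! ### The specialization `x_i = x^{n_i}` -/

section DiagonalSpecialization

variable {m : ℕ}

/-- The exponents `l` with `∑ n_i l_i = s` (for positive `n_i`). -/
def weightFiber (n : Fin m → ℕ) (s : ℕ) : Finset (Fin m →₀ ℕ) :=
  (Finset.Icc 0 (Finsupp.equivFunOnFinite.symm fun _ => s)).filter fun l => ∑ i, n i * l i = s

lemma mem_weightFiber {n : Fin m → ℕ} (hn : ∀ i, 1 ≤ n i) {s : ℕ} {l : Fin m →₀ ℕ} :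
    l ∈ weightFiber n s ↔ ∑ i, n i * l i = s := by
  simp only [weightFiber, Finset.mem_filter, Finset.mem_Icc, zero_le, true_and,
    and_iff_right_iff_imp]
  rintro rfl i
  simp only [Finsupp.equivFunOnFinite_symm_apply_apply]
  calc l i ≤ n i * l i := Nat.le_mul_of_pos_left _ (hn i)
    _ ≤ _ := Finset.single_le_sum (f := fun i => n i * l i) (fun _ _ => Nat.zero_le _)
      (Finset.mem_univ i)

lemma hasSubst_X_pow {n : Fin m → ℕ} (hn : ∀ i, 1 ≤ n i) :
    MvPowerSeries.HasSubst (fun i => (PowerSeries.X : PowerSeries ℝ) ^ n i) := by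
  refine MvPowerSeries.hasSubst_of_constantCoeff_zero fun i => ?_
  have h : PowerSeries.constantCoeff ((PowerSeries.X : PowerSeries ℝ) ^ n i) = 0 := by
    rw [map_pow, PowerSeries.constantCoeff_X, zero_pow (by have := hn i; omega)]
  exact h

lemma coeff_diagSpecialize {n : Fin m → ℕ} (hn : ∀ i, 1 ≤ n i) (f : MvPowerSeries (Fin m) ℝ)
    (s : ℕ) : PowerSeries.coeff s (diagSpecialize n f) =
      ∑ l ∈ weightFiber n s, MvPowerSeries.coeff l f := by
  have hprod : ∀ l : Fin m →₀ ℕ,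
      (l.prod fun i e => ((PowerSeries.X : PowerSeries ℝ) ^ n i) ^ e) =
        PowerSeries.X ^ (∑ i, n i * l i) := fun l => by
    rw [Finsupp.prod_fintype _ _ (by simp), ← Finset.prod_pow_eq_pow_sum]
    exact Finset.prod_congr rfl fun i _ => (pow_mul _ _ _).symm
  have hc : ∀ l : Fin m →₀ ℕ, MvPowerSeries.coeff (Finsupp.single () s)
      (l.prod fun i e => ((PowerSeries.X : PowerSeries ℝ) ^ n i) ^ e) =
        if s = ∑ i, n i * l i then 1 else 0 := fun l => by
    rw [hprod]
    exact PowerSeries.coeff_X_pow _ _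
  rw [PowerSeries.coeff, diagSpecialize, MvPowerSeries.coeff_subst (hasSubst_X_pow hn)]
  simp only [hc]
  rw [finsum_eq_sum_of_support_subset (s := weightFiber n s)]
  · refine Finset.sum_congr rfl fun l hl => ?_
    rw [if_pos ((mem_weightFiber hn).mp hl).symm, smul_eq_mul, mul_one]
  · intro l hl
    rw [Finset.mem_coe, mem_weightFiber hn]
    by_contra h
    exact hl (by simp only [if_neg (Ne.symm h), smul_zero])

lemma diagSpecialize_mul {n : Fin m → ℕ} (hn : ∀ i, 1 ≤ n i) (f g : MvPowerSeries (Fin m) ℝ) :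
    diagSpecialize n (f * g) = diagSpecialize n f * diagSpecialize n g :=
  MvPowerSeries.subst_mul (hasSubst_X_pow hn) f g

lemma constantCoeff_diagSpecialize {n : Fin m → ℕ} (hn : ∀ i, 1 ≤ n i)
    (f : MvPowerSeries (Fin m) ℝ) : PowerSeries.constantCoeff (diagSpecialize n f) =
      MvPowerSeries.constantCoeff f := by
  have : weightFiber n 0 = {0} := by
    ext l
    rw [mem_weightFiber hn, Finset.mem_singleton, Finset.sum_eq_zero_iff]
    constructor
    · intro h
      ext i
      exact (Nat.mul_eq_zero.mp (h i (Finset.mem_univ i))).resolve_left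
        (Nat.one_le_iff_ne_zero.mp (hn i))
    · rintro rfl; simp
  rw [← PowerSeries.coeff_zero_eq_constantCoeff_apply, coeff_diagSpecialize hn, this,
    Finset.sum_singleton, MvPowerSeries.coeff_zero_eq_constantCoeff_apply]

lemma diagSpecialize_rescale {n : Fin m → ℕ} (hn : ∀ i, 1 ≤ n i) (q : ℝ)
    (f : MvPowerSeries (Fin m) ℝ) :
    diagSpecialize n (MvPowerSeries.rescale (fun i => q ^ n i) f) =
      PowerSeries.rescale q (diagSpecialize n f) := by
  ext s
  rw [PowerSeries.coeff_rescale, coeff_diagSpecialize hn, coeff_diagSpecialize hn, Finset.mul_sum]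
  refine Finset.sum_congr rfl fun l hl => ?_
  rw [MvPowerSeries.coeff_rescale, Finsupp.prod_fintype _ _ (by simp)]
  congr 1
  rw [← (mem_weightFiber hn).mp hl, ← Finset.prod_pow_eq_pow_sum]
  exact Finset.prod_congr rfl fun i _ => (pow_mul _ _ _).symm

lemma diagSpecialize_mvLog {n : Fin m → ℕ} (hn : ∀ i, 1 ≤ n i) {f : MvPowerSeries (Fin m) ℝ}
    (hf : MvPowerSeries.constantCoeff f = 1) :
    diagSpecialize n (mvLog f) = PowerSeries.logOf (diagSpecialize n f) := by
  have h1 : diagSpecialize n (f - 1) = diagSpecialize n f - 1 := by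
    simp only [diagSpecialize, ← MvPowerSeries.coe_substAlgHom (hasSubst_X_pow hn), map_sub,
      map_one]
  rw [PowerSeries.logOf_eq, ← h1]
  exact MvPowerSeries.subst_comp_subst_apply (hasSubst_sub_one hf).const (hasSubst_X_pow hn) _

end DiagonalSpecialization

/-! ### The operator `x d/dx` and logarithmic derivatives -/

section EulerOperator

/-- The operator `x d/dx` on formal power series. -/
def euler (f : PowerSeries ℝ) : PowerSeries ℝ := PowerSeries.X * PowerSeries.derivative ℝ f

lemma coeff_euler (f : PowerSeries ℝ) (s : ℕ) :
    PowerSeries.coeff s (euler f) = s * PowerSeries.coeff s f := by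
  rcases s with _ | s
  · simp [euler]
  · rw [euler, PowerSeries.coeff_succ_X_mul, PowerSeries.coeff_derivative]
    push_cast
    ring

lemma euler_mul (f g : PowerSeries ℝ) : euler (f * g) = euler f * g + f * euler g := by
  simp only [euler, Derivation.leibniz, smul_eq_mul]
  ring

lemma euler_rescale (q : ℝ) (f : PowerSeries ℝ) :
    euler (PowerSeries.rescale q f) = PowerSeries.rescale q (euler f) := by
  ext s
  simp only [coeff_euler, PowerSeries.coeff_rescale]
  ring

lemma euler_logOf {f : PowerSeries ℝ} (hf : PowerSeries.constantCoeff f = 1) :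
    euler f = f * euler (PowerSeries.logOf f) := by
  have hs : PowerSeries.HasSubst (f - 1) := PowerSeries.HasSubst.of_constantCoeff_zero' (by simp [hf])
  have h1 : PowerSeries.derivative ℝ (PowerSeries.log ℝ) * (1 + PowerSeries.X) = 1 := by
    rw [PowerSeries.deriv_log]
    ext k
    rcases k with _ | k
    · simp
    · rw [mul_add, mul_one, map_add, PowerSeries.coeff_succ_mul_X, PowerSeries.coeff_mk,
        PowerSeries.coeff_mk, PowerSeries.coeff_one]
      simp [pow_succ]
  have h2 := congrArg (PowerSeries.subst (f - 1)) h1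
  rw [PowerSeries.subst_mul hs, PowerSeries.subst_add hs, PowerSeries.subst_X hs,
    ← PowerSeries.coe_substAlgHom hs, map_one, PowerSeries.coe_substAlgHom hs,
    add_sub_cancel] at h2
  rw [euler, euler, PowerSeries.logOf_eq, PowerSeries.derivative_subst hs, map_sub]
  simp only [Derivation.map_one_eq_zero, sub_zero]
  linear_combination (-PowerSeries.X * PowerSeries.derivative ℝ f) * h2

lemma euler_exp_subst {g : PowerSeries ℝ} (hg : PowerSeries.constantCoeff g = 0) :
    euler ((PowerSeries.exp ℝ).subst g) = (PowerSeries.exp ℝ).subst g * euler g := by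
  have hs : PowerSeries.HasSubst g := PowerSeries.HasSubst.of_constantCoeff_zero' hg
  rw [euler, euler, PowerSeries.derivative_subst hs, PowerSeries.derivative_exp]
  ring

lemma constantCoeff_exp_subst {g : PowerSeries ℝ} (hg : PowerSeries.constantCoeff g = 0) :
    PowerSeries.constantCoeff ((PowerSeries.exp ℝ).subst g) = 1 := by
  have hs : PowerSeries.HasSubst g := PowerSeries.HasSubst.of_constantCoeff_zero' hg
  have h : (PowerSeries.exp ℝ).subst g = (PowerSeries.exp ℝ - 1).subst g + 1 := by
    simp only [← PowerSeries.coe_substAlgHom hs, map_sub, map_one, sub_add_cancel]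
  have h0 : PowerSeries.constantCoeff ((PowerSeries.exp ℝ - 1).subst g) = 0 :=
    PowerSeries.constantCoeff_subst_eq_zero hg _ (by simp)
  rw [h, map_add, h0, map_one, zero_add]

lemma coeff_of_euler_eq_mul {f u : PowerSeries ℝ} (hf : PowerSeries.constantCoeff f = 1)
    (h : euler f = f * u) (s : ℕ) : PowerSeries.coeff s u = s * PowerSeries.coeff s f -
      ∑ p ∈ (Finset.HasAntidiagonal.antidiagonal s).erase (0, s), PowerSeries.coeff p.1 f *
        PowerSeries.coeff p.2 u := by
  have h1 := congrArg (PowerSeries.coeff s) h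
  rw [coeff_euler, PowerSeries.coeff_mul, ← Finset.add_sum_erase _ _
    (show (0, s) ∈ Finset.HasAntidiagonal.antidiagonal s by simp)] at h1
  simp only [PowerSeries.coeff_zero_eq_constantCoeff_apply, hf, one_mul] at h1
  linarith

lemma snd_lt_of_mem_erase_antidiagonal {s : ℕ} {p : ℕ × ℕ}
    (hp : p ∈ (Finset.HasAntidiagonal.antidiagonal s).erase (0, s)) : p.2 < s := by
  obtain ⟨a, b⟩ := p
  simp only [Finset.mem_erase, ne_eq, Prod.mk.injEq, Finset.HasAntidiagonal.mem_antidiagonal] at hp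
  show b < s
  omega

/-- Here `u` has no constant term, so `s` times the `s`-th coefficient of a solution is determined
by lower ones. -/
lemma eq_of_euler_eq_mul {f g u : PowerSeries ℝ} (hf : PowerSeries.constantCoeff f = 1)
    (hg : PowerSeries.constantCoeff g = 1) (huf : euler f = f * u) (hug : euler g = g * u) :
    f = g := by
  have hu : PowerSeries.constantCoeff u = 0 := by
    simpa [euler, hf] using (congrArg PowerSeries.constantCoeff huf).symm
  ext s
  induction s using Nat.strong_induction_on with
  | _ s ih =>
  rcases Nat.eq_zero_or_pos s with rfl | hs
  · simp [hf, hg]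
  have h1 := congrArg (PowerSeries.coeff s) huf
  have h2 := congrArg (PowerSeries.coeff s) hug
  rw [coeff_euler, PowerSeries.coeff_mul] at h1 h2
  have h3 : ∀ p ∈ Finset.HasAntidiagonal.antidiagonal s, PowerSeries.coeff p.1 f * PowerSeries.coeff p.2 u =
      PowerSeries.coeff p.1 g * PowerSeries.coeff p.2 u := by
    rintro ⟨a, b⟩ hp
    rw [Finset.HasAntidiagonal.mem_antidiagonal] at hp
    rcases Nat.eq_zero_or_pos b with rfl | hb
    · simp [hu]
    · rw [ih a (by simp at hp; omega)]
  rw [Finset.sum_congr rfl h3, ← h2] at h1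
  exact mul_left_cancel₀ (by positivity) h1

lemma exp_subst_logOf {f : PowerSeries ℝ} (hf : PowerSeries.constantCoeff f = 1) :
    (PowerSeries.exp ℝ).subst (PowerSeries.logOf f) = f :=
  have hl := PowerSeries.constantCoeff_logOf hf
  eq_of_euler_eq_mul (constantCoeff_exp_subst hl) hf (euler_exp_subst hl) (euler_logOf hf)

/-- Coefficients of the logarithmic derivative are polynomial in those of the series, by recursion,
so they inherit convergence. -/
lemma tendsto_coeff_of_euler_eq_mul {α : Type*} {F : Filter α} {f u : α → PowerSeries ℝ}
    {g w : PowerSeries ℝ} (hf : ∀ᶠ q in F, PowerSeries.constantCoeff (f q) = 1)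
    (hfu : ∀ᶠ q in F, euler (f q) = f q * u q) (hg : PowerSeries.constantCoeff g = 1)
    (hgw : euler g = g * w)
    (h : ∀ s, Tendsto (fun q => PowerSeries.coeff s (f q)) F (𝓝 (PowerSeries.coeff s g)))
    (s : ℕ) : Tendsto (fun q => PowerSeries.coeff s (u q)) F (𝓝 (PowerSeries.coeff s w)) := by
  induction s using Nat.strong_induction_on with
  | _ s ih =>
  rw [coeff_of_euler_eq_mul hg hgw]
  refine Tendsto.congr' (f₁ := fun q => s * PowerSeries.coeff s (f q) -
      ∑ p ∈ (Finset.HasAntidiagonal.antidiagonal s).erase (0, s), PowerSeries.coeff p.1 (f q) *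
        PowerSeries.coeff p.2 (u q)) ?_ ?_
  · filter_upwards [hf, hfu] with q h1 h2
    exact (coeff_of_euler_eq_mul h1 h2 s).symm
  · exact ((h s).const_mul _).sub (tendsto_finsetSum _ fun p hp =>
      (h p.1).mul (ih p.2 (snd_lt_of_mem_erase_antidiagonal hp)))

end EulerOperator

/-! ### Coefficients of `x (log y)'` -/

section LogDerivative

variable {m : ℕ}

lemma logDerivCoeff_eq {C : Matrix (Fin m) (Fin m) ℤ} (hC : C.IsSymm) {n : Fin m → ℕ}
    (hn : ∀ i, 1 ≤ n i) (r : ℕ) :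
    logDerivCoeff C n r = r * ∑ l ∈ weightFiber n r,
      MvPowerSeries.coeff l (mvLog (classicalLimit C n)) := by
  have h := coeff_euler (PowerSeries.logOf (diagSpecialize n (classicalLimit C n))) r
  rw [← diagSpecialize_mvLog hn (constantCoeff_classicalLimit hC n), coeff_diagSpecialize hn,
    diagSpecialize_mvLog hn (constantCoeff_classicalLimit hC n)] at h
  exact h

end LogDerivative

/-! ### Möbius inversion and the BPS limit -/

section BPSExpansion

variable {m : ℕ}

/-- Möbius inversion of `b_s(q) = ∑_{kr = s} f_r(q^k) / k`. -/
lemma mul_eq_sum_moebius {f b : ℕ → ℝ → ℝ}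
    (h : ∀ s > 0, ∀ q : ℝ, 0 < q → q < 1 →
      b s q = ∑ kr ∈ s.divisorsAntidiagonal, (1 / (kr.1 : ℝ)) * f kr.2 (q ^ kr.1))
    {r : ℕ} (hr : 0 < r) {q : ℝ} (hq : 0 < q) (hq1 : q < 1) :
    r * f r q = ∑ x ∈ r.divisorsAntidiagonal,
      (ArithmeticFunction.moebius x.1 : ℝ) * (x.2 * b x.2 (q ^ x.1)) := by
  -- Evaluating index `e` at `q^(r/e)` makes this an ordinary divisor sum on the divisors of `r`: if
  -- `k t = e`, then `(q^(r/e))^k = q^(r/t)`.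
  have key := (ArithmeticFunction.sum_eq_iff_sum_mul_moebius_eq_on (R := ℝ)
    (f := fun e => e * f e (q ^ (r / e))) (g := fun e => e * b e (q ^ (r / e)))
    {e | e ∣ r} (fun a b hab hb => hab.trans hb)).mp ?_ r hr dvd_rfl
  · rw [Nat.div_self hr, pow_one] at key
    rw [← key]
    refine Finset.sum_congr rfl fun x hx => ?_
    rw [← Nat.div_eq_of_eq_mul_left (Nat.pos_of_mem_divisors
      (Nat.snd_mem_divisors_of_mem_antidiagonal hx)) (Nat.mem_divisorsAntidiagonal.mp hx).1.symm]
  · intro e he her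
    have hre : r / e ≠ 0 := (Nat.div_pos (Nat.le_of_dvd hr her) he).ne'
    have hdiv : e.divisors = e.divisorsAntidiagonal.image Prod.snd := by
      rw [Nat.image_snd_divisorsAntidiagonal]
    rw [h e he _ (pow_pos hq _) (pow_lt_one₀ hq.le hq1 hre), Finset.mul_sum, hdiv,
      Finset.sum_image]
    · refine Finset.sum_congr rfl fun x hx => ?_
      obtain ⟨hx1, -⟩ := Nat.mem_divisorsAntidiagonal.mp hx
      have hx0 : (x.1 : ℝ) ≠ 0 := by
        rintro h0
        rw [Nat.cast_eq_zero.mp h0, zero_mul] at hx1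
        omega
      have hpos : 0 < x.2 := Nat.pos_of_ne_zero fun h0 => by rw [h0, mul_zero] at hx1; omega
      have hpow : r / x.2 = r / e * x.1 := by
        obtain ⟨t, rfl⟩ := her
        rw [Nat.mul_div_cancel_left _ he, ← hx1]
        exact Nat.div_eq_of_eq_mul_left hpos (by ring)
      rw [hpow, pow_mul, ← hx1]
      push_cast
      field_simp
    · intro x hx y hy hxy
      have h1 := (Nat.mem_divisorsAntidiagonal.mp hx).1
      have h2 := (Nat.mem_divisorsAntidiagonal.mp hy).1
      rw [hxy] at h1
      have hpos : 0 < y.2 := Nat.pos_of_ne_zero fun h0 => by rw [h0, mul_zero] at h2; omega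
      exact Prod.ext (Nat.eq_of_mul_eq_mul_right hpos (h1.trans h2.symm)) hxy

/-- The Möbius formula itself defines `f`; inversion on the divisors of `s`, in the other direction,
shows that it works. -/
lemma exists_sum_eq (b : ℕ → ℝ → ℝ) : ∃ f : ℕ → ℝ → ℝ, ∀ s > 0, ∀ q : ℝ,
    b s q = ∑ kr ∈ s.divisorsAntidiagonal, (1 / (kr.1 : ℝ)) * f kr.2 (q ^ kr.1) := by
  refine ⟨fun r q => (1 / (r : ℝ)) * ∑ x ∈ r.divisorsAntidiagonal,
    (ArithmeticFunction.moebius x.1 : ℝ) * (x.2 * b x.2 (q ^ x.1)), fun s hs q => ?_⟩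
  have key := (ArithmeticFunction.sum_eq_iff_sum_mul_moebius_eq_on (R := ℝ)
    (f := fun t => ∑ x ∈ t.divisorsAntidiagonal,
      (ArithmeticFunction.moebius x.1 : ℝ) * (x.2 * b x.2 (q ^ (s / x.2))))
    (g := fun e => e * b e (q ^ (s / e)))
    {e | e ∣ s} (fun a b hab hb => hab.trans hb)).mpr (fun _ _ _ => rfl) s hs dvd_rfl
  rw [Nat.div_self hs, pow_one, ← Nat.image_snd_divisorsAntidiagonal, Finset.sum_image] at key
  · have hs0 : (s : ℝ) ≠ 0 := by positivity
    rw [← mul_right_inj' hs0, ← key, Finset.mul_sum]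
    refine Finset.sum_congr rfl fun x hx => ?_
    obtain ⟨hx1, -⟩ := Nat.mem_divisorsAntidiagonal.mp hx
    have h1 : 0 < x.1 := Nat.pos_of_ne_zero fun h0 => by rw [h0, zero_mul] at hx1; omega
    have h2 : 0 < x.2 := Nat.pos_of_ne_zero fun h0 => by rw [h0, mul_zero] at hx1; omega
    have hc : (s : ℝ) * (1 / (x.1 : ℝ) * (1 / (x.2 : ℝ))) = 1 := by
      rw [← hx1]; push_cast; field_simp
    rw [← mul_assoc, ← mul_assoc, mul_assoc (s : ℝ), hc, one_mul]
    refine Finset.sum_congr rfl fun y hy => ?_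
    obtain ⟨hy1, -⟩ := Nat.mem_divisorsAntidiagonal.mp hy
    have h3 : 0 < y.2 := Nat.pos_of_ne_zero fun h0 => by rw [h0, mul_zero] at hy1; omega
    rw [← pow_mul, Nat.div_eq_of_eq_mul_left h3 (show s = x.1 * y.1 * y.2 by
      rw [← hx1, ← hy1]; ring)]
  · intro x hx y hy hxy
    have h1 := (Nat.mem_divisorsAntidiagonal.mp hx).1
    have h2 := (Nat.mem_divisorsAntidiagonal.mp hy).1
    rw [hxy] at h1
    have hpos : 0 < y.2 := Nat.pos_of_ne_zero fun h0 => by rw [h0, mul_zero] at h2; omega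
    exact Prod.ext (Nat.eq_of_mul_eq_mul_right hpos (h1.trans h2.symm)) hxy

lemma exists_isBPSExpansion (C : Matrix (Fin m) (Fin m) ℤ) {n : Fin m → ℕ} (hn : ∀ i, 1 ≤ n i) :
    ∃ f, IsBPSExpansion C n f := by
  obtain ⟨f, hf⟩ := exists_sum_eq fun s q =>
    PowerSeries.coeff s (PowerSeries.logOf (diagSpecialize n (quiverSeries C q)))
  refine ⟨f, fun q _ _ => ?_⟩
  have h1 : PowerSeries.constantCoeff (diagSpecialize n (quiverSeries C q)) = 1 := by
    rw [constantCoeff_diagSpecialize hn, constantCoeff_quiverSeries]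
  have h2 : (PowerSeries.mk fun s => ∑ kr ∈ s.divisorsAntidiagonal,
      (1 / (kr.1 : ℝ)) * f kr.2 (q ^ kr.1)) =
      PowerSeries.logOf (diagSpecialize n (quiverSeries C q)) := by
    ext s
    rw [PowerSeries.coeff_mk]
    rcases Nat.eq_zero_or_pos s with rfl | hs
    · simp [PowerSeries.constantCoeff_logOf h1]
    · exact (hf s hs q).symm
  rw [h2, exp_subst_logOf h1]

lemma eventually_mem_Ioo : ∀ᶠ q : ℝ in 𝓝[<] 1, 0 < q ∧ q < 1 := by
  filter_upwards [self_mem_nhdsWithin, nhdsWithin_le_nhds (lt_mem_nhds one_pos)] with q h1 h2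
  exact ⟨h2, h1⟩

/-- With `P = exp g`, the logarithmic derivative of `P(qx)/P(x)` is `(x g')(qx) - (x g')(x)`, whose
`s`-th coefficient is `s (q^s - 1) g_s`. -/
lemma tendsto_expansionCoeff {C : Matrix (Fin m) (Fin m) ℤ} (hC : C.IsSymm) {n : Fin m → ℕ}
    (hn : ∀ i, 1 ≤ n i) {f : ℕ → ℝ → ℝ} (hf : IsBPSExpansion C n f) (s : ℕ) :
    Tendsto (fun q : ℝ => (s * (q ^ s - 1)) * ∑ kr ∈ s.divisorsAntidiagonal,
      (1 / (kr.1 : ℝ)) * f kr.2 (q ^ kr.1)) (𝓝[<] 1) (𝓝 (logDerivCoeff C n s)) := by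
  set g : ℝ → PowerSeries ℝ := fun q => PowerSeries.mk fun s =>
    ∑ kr ∈ s.divisorsAntidiagonal, (1 / (kr.1 : ℝ)) * f kr.2 (q ^ kr.1) with hg
  have hg0 : ∀ q, PowerSeries.constantCoeff (g q) = 0 := fun q => by
    rw [← PowerSeries.coeff_zero_eq_constantCoeff_apply, hg, PowerSeries.coeff_mk]
    simp
  have hy : PowerSeries.constantCoeff (diagSpecialize n (classicalLimit C n)) = 1 := by
    rw [constantCoeff_diagSpecialize hn, constantCoeff_classicalLimit hC]
  have hH : ∀ q, PowerSeries.constantCoeff (diagSpecialize n (quiverSeries C q)) = 1 := fun q => by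
    rw [constantCoeff_diagSpecialize hn, constantCoeff_quiverSeries]
  have hQ : ∀ q, PowerSeries.constantCoeff (diagSpecialize n (quiverQuotient C n q)) = 1 := by
    intro q
    rw [constantCoeff_diagSpecialize hn, quiverQuotient, map_mul, MvPowerSeries.constantCoeff_inv,
      constantCoeff_quiverSeries, ← MvPowerSeries.coeff_zero_eq_constantCoeff_apply,
      MvPowerSeries.coeff_rescale, MvPowerSeries.coeff_zero_eq_constantCoeff_apply,
      constantCoeff_quiverSeries]
    simp
  have hmul : ∀ q, diagSpecialize n (quiverQuotient C n q) * diagSpecialize n (quiverSeries C q) =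
      PowerSeries.rescale q (diagSpecialize n (quiverSeries C q)) := fun q => by
    rw [← diagSpecialize_mul hn, ← diagSpecialize_rescale hn, quiverQuotient, mul_assoc,
      MvPowerSeries.inv_mul_cancel _ (by simp [constantCoeff_quiverSeries]), mul_one]
  have hlim := tendsto_coeff_of_euler_eq_mul (F := 𝓝[<] (1 : ℝ))
    (f := fun q => diagSpecialize n (quiverQuotient C n q))
    (u := fun q => PowerSeries.rescale q (euler (g q)) - euler (g q))
    (Eventually.of_forall hQ) ?_ hy (euler_logOf hy) ?_ s
  · refine hlim.congr fun q => ?_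
    simp only [map_sub, PowerSeries.coeff_rescale, coeff_euler, hg, PowerSeries.coeff_mk]
    ring
  · filter_upwards [eventually_mem_Ioo] with q hq
    have h1 : euler (diagSpecialize n (quiverSeries C q)) =
        diagSpecialize n (quiverSeries C q) * euler (g q) := by
      rw [hf q hq.1 hq.2]
      exact euler_exp_subst (hg0 q)
    have hne : diagSpecialize n (quiverSeries C q) ≠ 0 := fun h => by
      have := hH q
      simp [h] at this
    have h2 := congrArg euler (hmul q)
    rw [euler_mul, euler_rescale, h1, map_mul, ← hmul q] at h2
    apply mul_right_cancel₀ hne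
    linear_combination h2
  · intro s
    simp only [coeff_diagSpecialize hn]
    exact tendsto_finsetSum _ fun l _ => (tendsto_coeff_quiverQuotient hC n l).mono_left
      (nhdsWithin_mono _ fun q hq => ne_of_lt hq)

lemma tendsto_pow_nhdsLT_one {d : ℕ} (hd : 0 < d) :
    Tendsto (fun q : ℝ => q ^ d) (𝓝[<] 1) (𝓝[<] 1) := by
  refine tendsto_nhdsWithin_iff.mpr ⟨?_, ?_⟩
  · have := (continuous_pow d).tendsto (1 : ℝ)
    rw [one_pow] at this
    exact this.mono_left nhdsWithin_le_nhds
  · filter_upwards [eventually_mem_Ioo] with q hq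
    exact pow_lt_one₀ hq.1.le hq.2 hd.ne'

lemma tendsto_sub_one_div_pow_sub_one {d : ℕ} (hd : 0 < d) :
    Tendsto (fun q : ℝ => (q - 1) / (q ^ d - 1)) (𝓝[<] 1) (𝓝 (1 / d)) := by
  have h : Tendsto (fun q : ℝ => 1 / ∑ i ∈ Finset.range d, q ^ i) (𝓝[<] 1) (𝓝 (1 / d)) := by
    have hc : Continuous fun q : ℝ => ∑ i ∈ Finset.range d, q ^ i := by fun_prop
    have := hc.tendsto 1
    simp only [one_pow, Finset.sum_const, Finset.card_range, nsmul_eq_mul, mul_one] at this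
    exact (tendsto_const_nhds.div this (by positivity)).mono_left nhdsWithin_le_nhds
  refine h.congr' ?_
  filter_upwards [eventually_mem_Ioo] with q hq
  rw [← geom_sum_mul]
  have h1 : q - 1 ≠ 0 := by linarith [hq.2]
  rw [mul_comm, ← div_div, div_self h1]

lemma sqrt_sub_inv {q : ℝ} (hq : 0 < q) : √q - (√q)⁻¹ = (q - 1) / √q := by
  have h := (Real.sqrt_pos.mpr hq).ne'
  field_simp
  rw [Real.sq_sqrt hq.le]

/-- For `d e = r`, `(√q - 1/√q) b_e(q^d)` tends to `a_e / (e r)`, because `(q - 1)/(q^r - 1) → 1/r`.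
The Möbius weight `e/r` then gives `a_e / r^2`. -/
lemma tendsto_bps {C : Matrix (Fin m) (Fin m) ℤ} (hC : C.IsSymm) {n : Fin m → ℕ}
    (hn : ∀ i, 1 ≤ n i) {f : ℕ → ℝ → ℝ} (hf : IsBPSExpansion C n f) {r : ℕ} (hr : 1 ≤ r) :
    Tendsto (fun q : ℝ => (√q - (√q)⁻¹) * f r q) (𝓝[<] 1)
      (𝓝 (1 / (r : ℝ) ^ 2 * ∑ d ∈ r.divisors,
        (ArithmeticFunction.moebius d : ℝ) * logDerivCoeff C n (r / d))) := by
  set b : ℕ → ℝ → ℝ := fun s q => ∑ kr ∈ s.divisorsAntidiagonal,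
    (1 / (kr.1 : ℝ)) * f kr.2 (q ^ kr.1) with hb
  have hterm : ∀ d e : ℕ, 0 < d → 0 < e →
      Tendsto (fun q : ℝ => (√q - (√q)⁻¹) * b e (q ^ d)) (𝓝[<] 1)
        (𝓝 (1 / (d * e : ℕ) * (1 / e) * logDerivCoeff C n e)) := by
    intro d e hd he
    have h1 := (tendsto_expansionCoeff hC hn hf e).comp (tendsto_pow_nhdsLT_one hd)
    have h2 := tendsto_sub_one_div_pow_sub_one (Nat.mul_pos hd he)
    have h3 : Tendsto (fun q : ℝ => (√q)⁻¹) (𝓝[<] 1) (𝓝 1) := by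
      have := (Real.continuous_sqrt.tendsto 1).inv₀ (by simp)
      rw [Real.sqrt_one, inv_one] at this
      exact this.mono_left nhdsWithin_le_nhds
    have h4 := ((h3.mul h2).mul_const (1 / (e : ℝ))).mul h1
    rw [one_mul] at h4
    refine h4.congr' ?_
    filter_upwards [eventually_mem_Ioo] with q hq
    have hne : q ^ (d * e) - 1 ≠ 0 := by
      have := pow_lt_one₀ hq.1.le hq.2 (Nat.mul_pos hd he).ne'
      linarith
    have he0 : (e : ℝ) ≠ 0 := by positivity
    have hs := (Real.sqrt_pos.mpr hq.1).ne'
    rw [sqrt_sub_inv hq.1]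
    simp only [Function.comp_apply, ← pow_mul q d e]
    change _ * (_ * b e (q ^ d)) = _
    field_simp
  have hr0 : (r : ℝ) ≠ 0 := by positivity
  have hsum : Tendsto (fun q : ℝ => (1 / (r : ℝ)) * ∑ x ∈ r.divisorsAntidiagonal,
      (ArithmeticFunction.moebius x.1 : ℝ) * (x.2 * ((√q - (√q)⁻¹) * b x.2 (q ^ x.1)))) (𝓝[<] 1)
      (𝓝 ((1 / (r : ℝ)) * ∑ x ∈ r.divisorsAntidiagonal, (ArithmeticFunction.moebius x.1 : ℝ) *
        (x.2 * (1 / (x.1 * x.2 : ℕ) * (1 / x.2) * logDerivCoeff C n x.2)))) := by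
    refine (tendsto_finsetSum _ fun x hx => ?_).const_mul _
    exact ((hterm x.1 x.2
      (Nat.pos_of_mem_divisors (Nat.fst_mem_divisors_of_mem_antidiagonal hx))
      (Nat.pos_of_mem_divisors (Nat.snd_mem_divisors_of_mem_antidiagonal hx))).const_mul _).const_mul _
  have hval : (1 / (r : ℝ)) * ∑ x ∈ r.divisorsAntidiagonal, (ArithmeticFunction.moebius x.1 : ℝ) *
        (x.2 * (1 / (x.1 * x.2 : ℕ) * (1 / x.2) * logDerivCoeff C n x.2)) =
      1 / (r : ℝ) ^ 2 * ∑ d ∈ r.divisors,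
        (ArithmeticFunction.moebius d : ℝ) * logDerivCoeff C n (r / d) := by
    rw [← Nat.sum_divisorsAntidiagonal
      (f := fun d e => (ArithmeticFunction.moebius d : ℝ) * logDerivCoeff C n e),
      Finset.mul_sum, Finset.mul_sum]
    refine Finset.sum_congr rfl fun x hx => ?_
    have h2 : 0 < x.2 := Nat.pos_of_mem_divisors (Nat.snd_mem_divisors_of_mem_antidiagonal hx)
    rw [(Nat.mem_divisorsAntidiagonal.mp hx).1]
    field_simp
  rw [hval] at hsum
  refine hsum.congr' ?_
  filter_upwards [eventually_mem_Ioo] with q hq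
  have := mul_eq_sum_moebius (f := f) (b := b) (fun _ _ _ _ _ => rfl) hr hq.1 hq.2
  have h2 : f r q = (1 / (r : ℝ)) * (r * f r q) := by field_simp
  rw [h2, this, Finset.mul_sum, Finset.mul_sum, Finset.mul_sum]
  exact Finset.sum_congr rfl fun x _ => by ring

lemma tendsto_mul_bpsFunction (N : ℕ → ℤ →₀ ℝ) (r : ℕ) :
    Tendsto (fun q : ℝ => (√q - (√q)⁻¹) * bpsFunction N r q) (𝓝[<] 1)
      (𝓝 ((N r).sum fun _ v => v)) := by
  have h : Tendsto (fun q : ℝ => (N r).sum fun j v => v * (√q) ^ j) (𝓝[<] 1)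
      (𝓝 ((N r).sum fun _ v => v)) := by
    refine tendsto_finsetSum _ fun j _ => ?_
    have h1 : ContinuousAt (fun q : ℝ => (√q) ^ j) 1 :=
      ContinuousAt.zpow₀ Real.continuous_sqrt.continuousAt _ (by simp)
    have h2 := h1.tendsto
    simp only [Real.sqrt_one, one_zpow] at h2
    simpa using (h2.mono_left nhdsWithin_le_nhds).const_mul (N r j)
  refine h.congr' ?_
  filter_upwards [eventually_mem_Ioo] with q hq
  have hne : √q - (√q)⁻¹ ≠ 0 := by
    rw [sqrt_sub_inv hq.1]
    exact div_ne_zero (by linarith [hq.2]) (Real.sqrt_pos.mpr hq.1).ne'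
  rw [bpsFunction, mul_div_cancel₀ _ hne]

end BPSExpansion

end

/-! ### The main theorem -/

theorem mainTheorem2 {m : ℕ} (C : Matrix (Fin m) (Fin m) ℤ) (hC : C.IsSymm) (n : Fin m → ℕ) :
    -- the classical limit exists and has constant coefficient 1
    (∀ l : Fin m →₀ ℕ,
      Tendsto (fun q : ℝ => MvPowerSeries.coeff l (quiverQuotient C n q)) (𝓝[≠] 1)
        (𝓝 (MvPowerSeries.coeff l (classicalLimit C n)))) ∧
    MvPowerSeries.constantCoeff (classicalLimit C n) = 1 ∧
    ∃ c : (Fin m →₀ ℕ) → ℝ,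
      -- c l is the value of the formula, after cancellation
      (∀ l : Fin m →₀ ℕ, l ≠ 0 → HasValueAt (logTermRat (⇑l)) (parPoint C n) (c l)) ∧
      -- where no denominator vanishes, this is the formula itself
      (∀ l : Fin m →₀ ℕ, l ≠ 0 → (∀ j, n j ≠ 0) → (∀ j, ∑ i, C i j * (l i : ℤ) ≠ 0) →
        c l = logTerm (fun i j => (C i j : ℝ)) (fun j => (n j : ℝ)) (⇑l)) ∧
      -- the formula for log y
      MvPowerSeries.coeff 0 (mvLog (classicalLimit C n)) = 0 ∧
      (∀ l : Fin m →₀ ℕ, l ≠ 0 →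
        MvPowerSeries.coeff l (mvLog (classicalLimit C n)) =
          (-1 : ℝ) ^ (∑ i, (C i i + 1) * (l i : ℤ)) * c l) ∧
      ((∀ i, 1 ≤ n i) →
        -- the logarithmic derivative after the specialization x_i = x ^ (n_i)
        (∀ r : ℕ, logDerivCoeff C n r =
          ∑ᶠ l ∈ {l : Fin m →₀ ℕ | l ≠ 0 ∧ ∑ i, n i * l i = r},
            (-1 : ℝ) ^ (∑ i, (C i i + 1) * (l i : ℤ)) * c l * (∑ i, (n i : ℝ) * (l i : ℝ))) ∧
        -- the BPS-like numbers, by Möbius inversion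
        (∃ f, IsBPSExpansion C n f) ∧
        (∀ f, IsBPSExpansion C n f → ∀ r : ℕ, 1 ≤ r →
          Tendsto (fun q : ℝ => (√q - (√q)⁻¹) * f r q) (𝓝[<] 1)
            (𝓝 (1 / (r : ℝ) ^ 2 * ∑ d ∈ r.divisors,
              (ArithmeticFunction.moebius d : ℝ) * logDerivCoeff C n (r / d)))) ∧
        (∀ N : ℕ → ℤ →₀ ℝ, IsBPSExpansion C n (bpsFunction N) → ∀ r : ℕ, 1 ≤ r →
          ((N r).sum fun _ v => v) = 1 / (r : ℝ) ^ 2 * ∑ d ∈ r.divisors,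
            (ArithmeticFunction.moebius d : ℝ) * logDerivCoeff C n (r / d))) := by
  refine ⟨tendsto_coeff_quiverQuotient hC n, constantCoeff_classicalLimit hC n,
    fun l => cancelledTerm (fun i j => (C i j : ℝ)) (fun i => (n i : ℝ)) l, ?_, ?_, ?_,
    coeff_mvLog_classicalLimit hC n, ?_⟩
  · intro l hl
    exact hasValueAt_logTermRat C n l fun h => hl (DFunLike.coe_injective h)
  · intro l hl hn hX
    refine (logTerm_eq_cancelledTerm _ _ _ (fun h => hl (DFunLike.coe_injective h)) ?_ ?_).symm
    · exact fun j => Nat.cast_ne_zero.mpr (hn j)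
    · intro j h
      refine hX j ?_
      have : ((∑ i, C i j * (l i : ℤ) : ℤ) : ℝ) = 0 := by
        rw [← h, inflow]
        push_cast
        rfl
      exact_mod_cast this
  · rw [coeff_mvLog (constantCoeff_classicalLimit hC n)]
    simp
  · intro hn
    refine ⟨fun r => ?_, exists_isBPSExpansion C hn, fun f hf r hr => tendsto_bps hC hn hf hr,
      fun N hN r hr => tendsto_nhds_unique (tendsto_mul_bpsFunction N r) (tendsto_bps hC hn hN hr)⟩
    have hset : {l : Fin m →₀ ℕ | l ≠ 0 ∧ ∑ i, n i * l i = r} =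
        ((weightFiber n r).erase 0 : Finset (Fin m →₀ ℕ)) := by
      ext l
      simp [mem_weightFiber hn, and_comm]
    rw [hset, finsum_mem_coe_finset, logDerivCoeff_eq hC hn, Finset.mul_sum]
    have h0 : ∀ l ∈ weightFiber n r, l ∉ (weightFiber n r).erase 0 →
        (r : ℝ) * MvPowerSeries.coeff l (mvLog (classicalLimit C n)) = 0 := by
      intro l hl hl'
      have : l = 0 := by
        by_contra h
        exact hl' (Finset.mem_erase.mpr ⟨h, hl⟩)
      rw [this, coeff_mvLog (constantCoeff_classicalLimit hC n)]
      simp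
    rw [← Finset.sum_subset (Finset.erase_subset _ _) h0]
    refine Finset.sum_congr rfl fun l hl => ?_
    obtain ⟨hl0, hl1⟩ := Finset.mem_erase.mp hl
    have hr : (r : ℝ) = ∑ i, (n i : ℝ) * (l i : ℝ) := by
      rw [← (mem_weightFiber hn).mp hl1]
      push_cast
      rfl
    rw [coeff_mvLog_classicalLimit hC n l hl0, hr]
    ring
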